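/- Let $q$ be an indeterminate. For integers $m,k\ge 0$ let $[m]=(1-q^m)/(1-q)$ be the $q$-integer and $(a;q)_k=(1-a)(1-aq)\cdots(1-aq^{k-1})$ the $q$-shifted factorial, let $\Phi_n(q)$ be the $n$-th cyclotomic polynomial, and put $$B(n,q)=\frac{(n^2-1)(1-q)^2}{24}+\sum_{k=1}^{(n-1)/4}\frac{q^{4k-2}}{[4k-2]^2}.$$ Two rational functions $R,S\in\mathbb{Q}(q)$ are called congruent modulo a polynomial $P\in\mathbb{Q}[q]$ if $P$ divides the numerator of $R-S$ written in lowest terms. **Theorem 2.** Let $n$ be a positive integer with $n\equiv 1\pmod 4$. Then, modulo $[n]\Phi_n(q)^3$, $$\sum_{k=0}^{(n-1)/2}[6k+1]\frac{(q;q^4)_k\,(q;q^2)_k^3}{(q^2;q^2)_k\,(q^4;q^4)_k^3}\,q^{k^2+k}\equiv\frac{(q^2;q^4)_{(n-1)/4}}{(q^4;q^4)_{(n-1)/4}}\,[n]\,q^{(1-n)/4}\bigl\{1+[n]^2B(n,q)\bigr\}.$$ -/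

import Mathlib

namespace QCong

section

variable {F : Type*} [Field F]

/-- The `q`-shifted factorial `(a; q)_n = (1 - a) (1 - a q) ⋯ (1 - a q ^ (n - 1))`. -/
def qPoch (a q : F) (n : ℕ) : F :=
  ∏ i ∈ Finset.range n, (1 - a * q ^ i)

/-- The `q`-integer `[n] = (1 - q ^ n) / (1 - q)`. -/
def qInt (q : F) (n : ℕ) : F :=
  (1 - q ^ n) / (1 - q)

/-- `B(n, q) = (n² - 1) (1 - q)² / 24 + ∑_{k = 1}^{(n - 1) / 4} q ^ (4 k - 2) / [4 k - 2]²`.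
The natural number subtraction `4 * k - 2` is exact, since `k ≥ 1` in the sum. -/
def B (n : ℕ) (q : F) : F :=
  ((n : F) ^ 2 - 1) * (1 - q) ^ 2 / 24 +
    ∑ k ∈ Finset.Icc 1 ((n - 1) / 4), q ^ (4 * k - 2) / qInt q (4 * k - 2) ^ 2

end

/-- The `q`-integer `[n] = 1 + q + ⋯ + q ^ (n - 1)` as a polynomial in `q` (used as a modulus). -/
noncomputable def qIntPoly (n : ℕ) : Polynomial ℚ :=
  ∑ i ∈ Finset.range n, Polynomial.X ^ i

/-- The polynomial `[n]` is the `q`-integer `(1 - q ^ n) / (1 - q)`, with `q` the indeterminate. -/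
theorem algebraMap_qIntPoly (n : ℕ) :
    algebraMap (Polynomial ℚ) (RatFunc ℚ) (qIntPoly n) = qInt RatFunc.X n := by
  have hX : (RatFunc.X : RatFunc ℚ) ≠ 1 := by
    rw [← RatFunc.algebraMap_X, ← map_one (algebraMap (Polynomial ℚ) (RatFunc ℚ))]
    intro h
    have h2 := congrArg (Polynomial.eval 0) (RatFunc.algebraMap_injective ℚ h)
    simp at h2
  have h1 : (1 : RatFunc ℚ) - RatFunc.X ≠ 0 := sub_ne_zero.mpr hX.symm
  rw [qInt, eq_div_iff h1, qIntPoly, map_sum]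
  simp only [map_pow, RatFunc.algebraMap_X]
  exact geom_sum_mul_neg _ _

/-- Congruence of rational functions `R ≡ S (mod P)` modulo a polynomial `P`: the polynomial `P`
divides the numerator of `R - S` written in lowest terms (so `P` is automatically coprime to the
reduced denominator of `R - S`). -/
def RatCongr (P : Polynomial ℚ) (R S : RatFunc ℚ) : Prop :=
  P ∣ (R - S).num

end QCong

/-! Deform the sum by two parameters. With `w = x + 1/x`, let `S(w, z)` be `hypSum`; at `w = 2`, `z
= 1` it is `1 - q` times the left-hand side. The whole proof rests on the contiguous relation
`hypSum_shift` for `z ↦ z * q ^ 4`, whose boundary term is explicit and is zero in three useful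
situations.

At a primitive root of unity of odd order `d = 2 * M + 1`, truncation at `M` removes the boundary
term. After `d` shifts `z` returns to itself, and the accumulated factors force `S = 0` for generic
`x` and `z`. Hence `S` with cleared denominators is divisible by the cyclotomic polynomial as a
polynomial in `w` and `z` (`cyclotomic_dvd_polySum`). If instead `z = q ^ n` or `x = q ^ n`, with `n
= 4 * m + 1`, the series terminates and has a product formula (`hypSum_pow`,
`hypSum_quadratic_one`).

The denominator of `S` is a function of `w` times a function of `z`. So the mixed second difference
of `S` over `w ∈ {2, q ^ n + q ^ (-n)}`, `z ∈ {1, q ^ n}` is divisible by `Φ_n * (1 - q ^ n) ^ 3`,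
hence by `Φ_n ^ 4` (`hypSum_mixed_difference`). Three corners are known products: one gives the main
term, and the other two differ by `(1 - q ^ n) ^ 3` times a quantity needed only modulo `Φ_n`.
Evaluating sums and products over roots of unity turns that quantity into `B(n, q)`.

For a divisor `d` of `n` with `1 < d < n`, a single factor `Φ_d` suffices. At a root of order `d`
the sum splits into blocks that vanish, and the right-hand side contains `1 - q ^ n`. Coprimality of
the cyclotomic factors of `[n]` combines the two cases. -/

namespace QCong

open Finset Polynomial

/-! ### The two-parameter series and its contiguous relation -/

section CommRing

variable {R : Type*} [CommRing R]

/-- The numerator of the ratio of consecutive terms of the quadratic series, apart from the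
very-well-poised factor. Here `w = x + 1 / x`. -/
def ratioNum (q w z : R) (i : ℕ) : R :=
  (1 - q ^ (2 * i + 1)) * (1 + q ^ (4 * i + 2) - w * q ^ (2 * i + 1)) * (z - q ^ (4 * i + 1)) *
    q ^ (2 * i + 2)

/-- The denominator of the ratio of consecutive terms of the quadratic series. -/
def ratioDen (q w z : R) (i : ℕ) : R :=
  (1 - q ^ (4 * i + 4)) * (1 + q ^ (8 * i + 8) - w * q ^ (4 * i + 4)) * (1 - z * q ^ (2 * i + 2))

/-- The truncated quadratic series with its denominators cleared. -/
def polySum (M : ℕ) (q w z : R) : R :=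
  ∑ k ∈ range (M + 1), (1 - q ^ (6 * k + 1)) *
    ((∏ i ∈ range k, ratioNum q w z i) * ∏ i ∈ Ico k M, ratioDen q w z i)

theorem map_polySum {S : Type*} [CommRing S] (f : R →+* S) (M : ℕ) (q w z : R) :
    f (polySum M q w z) = polySum M (f q) (f w) (f z) := by
  simp [polySum, ratioNum, ratioDen, map_sum, map_prod]

end CommRing

section Field

variable {F : Type*} [Field F]

/-- The term of the quadratic series, apart from the very-well-poised factor. -/
def hypTerm (q w z : F) (k : ℕ) : F :=
  ∏ i ∈ range k, ratioNum q w z i / ratioDen q w z i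

/-- The truncated quadratic series. -/
def hypSum (M : ℕ) (q w z : F) : F :=
  ∑ k ∈ range (M + 1), (1 - q ^ (6 * k + 1)) * hypTerm q w z k

theorem hypTerm_succ (q w z : F) (k : ℕ) :
    hypTerm q w z (k + 1) = hypTerm q w z k * (ratioNum q w z k / ratioDen q w z k) :=
  prod_range_succ _ _

theorem hypSum_succ (M : ℕ) (q w z : F) :
    hypSum (M + 1) q w z = hypSum M q w z + (1 - q ^ (6 * (M + 1) + 1)) * hypTerm q w z (M + 1) :=
  sum_range_succ _ _

/-- Passing to `polySum` makes interpolation in `w` and `z` possible, since it is polynomial in all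
its arguments. -/
theorem polySum_eq_hypSum_mul {M : ℕ} {q w z : F} (h : ∀ i < M, ratioDen q w z i ≠ 0) :
    polySum M q w z = hypSum M q w z * ∏ i ∈ range M, ratioDen q w z i := by
  rw [polySum, hypSum, sum_mul]
  refine sum_congr rfl fun k hk => ?_
  have hk : k ≤ M := by simpa [Nat.lt_succ_iff] using hk
  rw [hypTerm, prod_div_distrib, ← prod_range_mul_prod_Ico _ hk]
  have : ∏ i ∈ range k, ratioDen q w z i ≠ 0 :=
    prod_ne_zero_iff.mpr fun i hi => h i (by simp at hi; omega)
  field_simp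

/-- The factors of the terms of the quadratic series that involve `z`. -/
def hypTermZ (q z : F) (k : ℕ) : F :=
  ∏ i ∈ range k, (z - q ^ (4 * i + 1)) / (1 - z * q ^ (2 * i + 2))

/-- The factors of the terms of the quadratic series that do not involve `z`. -/
def hypTermW (q w : F) (k : ℕ) : F :=
  ∏ i ∈ range k, (1 - q ^ (2 * i + 1)) * (1 + q ^ (4 * i + 2) - w * q ^ (2 * i + 1)) *
    q ^ (2 * i + 2) / ((1 - q ^ (4 * i + 4)) * (1 + q ^ (8 * i + 8) - w * q ^ (4 * i + 4)))

theorem hypTermZ_succ (q z : F) (k : ℕ) : hypTermZ q z (k + 1) =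
    hypTermZ q z k * ((z - q ^ (4 * k + 1)) / (1 - z * q ^ (2 * k + 2))) :=
  prod_range_succ _ _

theorem hypTermW_succ (q w : F) (k : ℕ) : hypTermW q w (k + 1) = hypTermW q w k *
    ((1 - q ^ (2 * k + 1)) * (1 + q ^ (4 * k + 2) - w * q ^ (2 * k + 1)) * q ^ (2 * k + 2) /
      ((1 - q ^ (4 * k + 4)) * (1 + q ^ (8 * k + 8) - w * q ^ (4 * k + 4)))) :=
  prod_range_succ _ _

theorem hypTerm_eq_mul (q w z : F) (k : ℕ) :
    hypTerm q w z k = hypTermW q w k * hypTermZ q z k := by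
  rw [hypTerm, hypTermW, hypTermZ, ← prod_mul_distrib]
  refine prod_congr rfl fun i _ => ?_
  rw [div_mul_div_comm, ratioNum, ratioDen]
  congr 1
  ring

/-- The effect of the shift `z ↦ z * q ^ 4` on the terms of the quadratic series. -/
theorem hypTermZ_shift {q z : F} (hz : ∀ i, 1 - z * q ^ (2 * i + 2) ≠ 0) (k : ℕ) :
    hypTermZ q (z * q ^ 4) (k + 1) = hypTermZ q z k *
      ((z * q ^ 4 - q) * q ^ (4 * k) * ((1 - z * q ^ 2) * (1 - z * q ^ 4))) /
        ((1 - z * q ^ (2 * k + 2)) * (1 - z * q ^ (2 * k + 4)) * (1 - z * q ^ (2 * k + 6))) := by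
  induction k with
  | zero =>
    have h1 : 1 - z * q ^ 2 ≠ 0 := hz 0
    have h2 : 1 - z * q ^ 4 ≠ 0 := hz 1
    simp only [hypTermZ, prod_range_succ, range_zero, prod_empty]
    norm_num
    rw [mul_comm (z * q ^ 4 - q), mul_div_mul_left _ _ (mul_ne_zero h1 h2)]
    ring
  | succ k ih =>
    have h1 : 1 - z * q ^ (2 * k + 2) ≠ 0 := hz k
    have h2 : 1 - z * q ^ (2 * k + 4) ≠ 0 := hz (k + 1)
    have h3 : 1 - z * q ^ (2 * k + 6) ≠ 0 := hz (k + 2)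
    have h4 : 1 - z * q ^ (2 * k + 8) ≠ 0 := hz (k + 3)
    rw [hypTermZ_succ, ih, hypTermZ_succ,
      show z * q ^ 4 * q ^ (2 * (k + 1) + 2) = z * q ^ (2 * k + 8) by ring,
      show 2 * (k + 1) + 2 = 2 * k + 4 by ring, show 2 * (k + 1) + 4 = 2 * k + 6 by ring,
      show 2 * (k + 1) + 6 = 2 * k + 8 by ring,
      show z * q ^ 4 - q ^ (4 * (k + 1) + 1) = (z - q ^ (4 * k + 1)) * q ^ 4 by ring,
      show q ^ (4 * (k + 1)) = q ^ (4 * k) * q ^ 4 by ring]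
    generalize 1 - z * q ^ (2 * k + 2) = d1 at *
    generalize 1 - z * q ^ (2 * k + 4) = d2 at *
    generalize 1 - z * q ^ (2 * k + 6) = d3 at *
    generalize 1 - z * q ^ (2 * k + 8) = d4 at *
    field_simp

/-- The contiguous relation of the quadratic series under `z ↦ z * q ^ 4`. -/
theorem hypSum_shift {q w z : F} (hz : ∀ i, 1 - z * q ^ (2 * i + 2) ≠ 0) (K : ℕ)
    (hd : ∀ i < K, 1 - q ^ (4 * i + 4) ≠ 0)
    (hb : ∀ i < K, 1 + q ^ (8 * i + 8) - w * q ^ (4 * i + 4) ≠ 0) :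
    (1 + q ^ 6 * z ^ 2 - w * q ^ 3 * z) * hypSum K q w (z * q ^ 4) =
      (1 - z * q ^ 2) * (1 - z * q ^ 4) * hypSum K q w z +
      (1 - z * q ^ 2) * (1 - z * q ^ 4) * (z * q ^ (2 * K + 2) * (1 - q ^ (2 * K + 1)) *
        (1 + q ^ (4 * K + 2) - w * q ^ (2 * K + 1))) * hypTerm q w z K /
          ((1 - z * q ^ (2 * K + 2)) * (1 - z * q ^ (2 * K + 4))) := by
  induction K with
  | zero =>
    have h1 : 1 - z * q ^ 2 ≠ 0 := hz 0
    have h2 : 1 - z * q ^ 4 ≠ 0 := hz 1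
    simp only [hypSum, hypTerm, zero_add, range_one, sum_singleton, range_zero, prod_empty,
      mul_zero, pow_one, mul_one]
    rw [mul_div_cancel_left₀ _ (mul_ne_zero h1 h2)]
    ring
  | succ K ih =>
    have h1 : 1 - z * q ^ (2 * K + 2) ≠ 0 := hz K
    have h2 : 1 - z * q ^ (2 * K + 4) ≠ 0 := hz (K + 1)
    have h3 : 1 - z * q ^ (2 * K + 6) ≠ 0 := hz (K + 2)
    have h4 := hd K (by omega)
    have h5 := hb K (by omega)
    rw [hypSum_succ, hypSum_succ, mul_add, ih (fun i hi => hd i (by omega))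
      (fun i hi => hb i (by omega)), hypTerm_eq_mul q w (z * q ^ 4),
      hypTermZ_shift hz, hypTerm_eq_mul, hypTerm_eq_mul, hypTermW_succ, hypTermZ_succ]
    generalize hypTermW q w K = t
    generalize hypTermZ q z K = t'
    generalize hypSum K q w z = S
    rw [show 2 * (K + 1) + 2 = 2 * K + 4 by ring, show 2 * (K + 1) + 4 = 2 * K + 6 by ring]
    -- The telescoping certificate: the increments of the two sides, with the factors common to all
    -- terms removed.
    have e : (1 + q ^ 6 * z ^ 2 - w * q ^ 3 * z) * (1 - q ^ (6 * (K + 1) + 1)) *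
        (z * q ^ 4 - q) * q ^ (4 * K) * q ^ (2 * K + 2) + z * q ^ (2 * K + 2) *
        ((1 - q ^ (4 * K + 4)) * (1 + q ^ (8 * K + 8) - w * q ^ (4 * K + 4))) *
          (1 - z * q ^ (2 * K + 6)) =
        q ^ (2 * K + 2) * (z - q ^ (4 * K + 1)) * ((1 - q ^ (6 * (K + 1) + 1)) *
        (1 - z * q ^ (2 * K + 4)) * (1 - z * q ^ (2 * K + 6)) +
         (z * q ^ (2 * K + 4) * (1 - q ^ (2 * (K + 1) + 1)) *
        (1 + q ^ (4 * (K + 1) + 2) - w * q ^ (2 * (K + 1) + 1)))) := by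
      ring
    generalize 1 - z * q ^ (2 * K + 2) = d1 at *
    generalize 1 - z * q ^ (2 * K + 4) = d2 at *
    generalize 1 - z * q ^ (2 * K + 6) = d3 at *
    generalize 1 - q ^ (4 * K + 4) = d4 at *
    generalize 1 + q ^ (8 * K + 8) - w * q ^ (4 * K + 4) = d5 at *
    generalize q ^ (2 * (K + 1) + 1) = x1 at *
    generalize q ^ (4 * (K + 1) + 2) = x2 at *
    generalize 1 - q ^ (6 * (K + 1) + 1) = x3 at *
    generalize q ^ (2 * K + 1) = x4 at *
    generalize q ^ (4 * K + 1) = x5 at *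
    generalize q ^ (4 * K + 2) = x6 at *
    generalize q ^ (2 * K + 2) = x7 at *
    generalize q ^ (2 * K + 4) = x8 at *
    generalize q ^ (4 * K) = x9 at *
    generalize 1 + q ^ 6 * z ^ 2 - w * q ^ 3 * z = A at *
    generalize z * q ^ 4 - q = x10 at *
    generalize 1 - z * q ^ 4 = x11 at *
    generalize 1 - z * q ^ 2 = x12 at *
    rw [← sub_eq_zero] at e ⊢
    trans (t * t' * (1 - x4) * (1 + x6 - w * x4) * x11 * x12 / (d1 * d2 * d3 * d4 * d5)) * 0
    · rw [← e]
      field_simp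
      ring
    · simp

end Field

/-! ### Vanishing at roots of unity of odd order -/

theorem prod_one_sub_mul_pow_of_isPrimitiveRoot {L : Type*} [Field L] {μ : L} {d : ℕ}
    (hd : 0 < d) (hμ : IsPrimitiveRoot μ d) (c : L) :
    ∏ i ∈ range d, (1 - c * μ ^ i) = 1 - c ^ d := by
  classical
  have : NeZero d := ⟨hd.ne'⟩
  have h := hμ.pow_sub_pow_eq_prod_sub_mul 1 c hd
  rw [one_pow] at h
  rw [h]
  refine prod_bij (fun i _ => μ ^ i) ?_ ?_ ?_ ?_
  · intro i _
    rw [mem_nthRootsFinset hd, ← pow_mul, mul_comm, pow_mul, hμ.pow_eq_one, one_pow]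
  · intro i hi j hj hij
    exact hμ.pow_inj (by simpa using hi) (by simpa using hj) hij
  · intro x hx
    obtain ⟨i, hi, rfl⟩ := hμ.eq_pow_of_pow_eq_one ((mem_nthRootsFinset hd _).mp hx)
    exact ⟨i, by simpa using hi, rfl⟩
  · intro i _
    ring

section

variable {L : Type*} [Field L] {ζ : L} {M : ℕ}

theorem one_sub_mul_pow_ne_zero {d : ℕ} (hζ : ζ ^ d = 1) {c : L} (hc : c ^ d ≠ 1) (j : ℕ) :
    1 - c * ζ ^ j ≠ 0 := by
  intro h
  apply hc
  have h1 : c * ζ ^ j = 1 := (sub_eq_zero.mp h).symm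
  have h2 := congrArg (· ^ d) h1
  simpa [mul_pow, ← pow_mul, mul_comm j d, pow_mul ζ d, hζ] using h2

theorem quadratic_ne_zero_of_generic {d : ℕ} (hζ : ζ ^ d = 1) {x : L} (hx0 : x ≠ 0)
    (hx : x ^ d ≠ 1) (i : ℕ) : 1 + ζ ^ (8 * i + 8) - (x + x⁻¹) * ζ ^ (4 * i + 4) ≠ 0 := by
  have hx' : x⁻¹ ^ d ≠ 1 := by rwa [inv_pow, ne_eq, inv_eq_one]
  convert mul_ne_zero (one_sub_mul_pow_ne_zero hζ hx (4 * i + 4))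
    (one_sub_mul_pow_ne_zero hζ hx' (4 * i + 4)) using 1
  field_simp
  ring

theorem _root_.IsPrimitiveRoot.one_sub_pow_four_mul_ne_zero (hζ : IsPrimitiveRoot ζ (2 * M + 1))
    (i : ℕ) (hi : i < M) : 1 - ζ ^ (4 * i + 4) ≠ 0 := by
  intro h
  have h1 := (hζ.pow_eq_one_iff_dvd _).mp (sub_eq_zero.mp h).symm
  rw [show 4 * i + 4 = 2 ^ 2 * (i + 1) by ring] at h1
  have h2 : Nat.Coprime (2 * M + 1) 2 := by simp
  have := Nat.le_of_dvd (by omega) ((h2.pow_right 2).dvd_of_dvd_mul_left h1)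
  omega

/-- At a root of unity of odd order, the truncated quadratic series vanishes generically. -/
theorem hypSum_eq_zero_of_generic (hζ : IsPrimitiveRoot ζ (2 * M + 1)) {x z : L} (hx0 : x ≠ 0)
    (hx : x ^ (2 * M + 1) ≠ 1) (hz0 : z ≠ 0) (hz : z ^ (2 * M + 1) ≠ 1) :
    hypSum M ζ (x + x⁻¹) z = 0 := by
  have h1 := hζ.pow_eq_one
  have hζ4 : IsPrimitiveRoot (ζ ^ 4) (2 * M + 1) := by
    refine hζ.pow_of_coprime 4 ?_
    rw [show 4 = 2 ^ 2 by norm_num]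
    exact Nat.Coprime.pow_left 2 (by simp)
  have hd := hζ.one_sub_pow_four_mul_ne_zero
  have hb : ∀ i < M, 1 + ζ ^ (8 * i + 8) - (x + x⁻¹) * ζ ^ (4 * i + 4) ≠ 0 := fun i _ =>
    quadratic_ne_zero_of_generic h1 hx0 hx i
  set S : ℕ → L := fun j => hypSum M ζ (x + x⁻¹) (z * (ζ ^ 4) ^ j) with hS
  have step : ∀ j, ((1 - (ζ ^ 3 * z * x) * (ζ ^ 4) ^ j) * (1 - (ζ ^ 3 * z * x⁻¹) * (ζ ^ 4) ^ j)) *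
      S (j + 1) = ((1 - (z * ζ ^ 2) * (ζ ^ 4) ^ j) * (1 - (z * ζ ^ 4) * (ζ ^ 4) ^ j)) * S j := by
    intro j
    have hz' : (z * (ζ ^ 4) ^ j) ^ (2 * M + 1) ≠ 1 := by
      rwa [mul_pow, ← pow_mul, mul_comm j, pow_mul, hζ4.pow_eq_one, one_pow, mul_one]
    have := hypSum_shift (w := x + x⁻¹)
      (fun i => one_sub_mul_pow_ne_zero h1 hz' (2 * i + 2)) M hd hb
    -- The boundary term carries `1 - ζ ^ (2 * M + 1) = 0`.
    rw [h1, sub_self, mul_zero, zero_mul, mul_zero, zero_mul, zero_div, add_zero] at this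
    simp only [hS]
    rw [pow_succ (ζ ^ 4) j, ← mul_assoc z]
    convert this using 1
    · field_simp
      ring
    · ring
  have iter : ∀ J, (∏ j ∈ range J, ((1 - (ζ ^ 3 * z * x) * (ζ ^ 4) ^ j) *
      (1 - (ζ ^ 3 * z * x⁻¹) * (ζ ^ 4) ^ j))) * S J =
      (∏ j ∈ range J, ((1 - (z * ζ ^ 2) * (ζ ^ 4) ^ j) *
        (1 - (z * ζ ^ 4) * (ζ ^ 4) ^ j))) * S 0 := by
    intro J
    induction J with
    | zero => simp
    | succ J ih =>
      rw [prod_range_succ, prod_range_succ, mul_assoc, step, mul_left_comm, ih]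
      ring
  have key := iter (2 * M + 1)
  simp only [prod_mul_distrib,
    prod_one_sub_mul_pow_of_isPrimitiveRoot (Nat.add_one_pos (2 * M)) hζ4] at key
  have hS' : S (2 * M + 1) = S 0 := by simp only [hS]; rw [hζ4.pow_eq_one, pow_zero]
  have e : ∀ j, (ζ ^ j) ^ (2 * M + 1) = 1 := fun j => by
    rw [← pow_mul, mul_comm, pow_mul, h1, one_pow]
  simp only [hS', mul_pow, e, inv_pow] at key
  have hx2 := pow_ne_zero (2 * M + 1) hx0
  have hz2 := pow_ne_zero (2 * M + 1) hz0
  generalize x ^ (2 * M + 1) = X at *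
  generalize z ^ (2 * M + 1) = Z at *
  -- The full cycle of shifts gives `(1 - Z * X) * (1 - Z / X) * S 0 = (1 - Z) ^ 2 * S 0`, and the
  -- two factors differ by `Z * (X - 1) ^ 2 / X`.
  have : (X - 1) ^ 2 * Z * S 0 = 0 := by
    field_simp at key
    linear_combination -key
  have := (mul_eq_zero.mp this).resolve_left
    (mul_ne_zero (pow_ne_zero 2 (sub_ne_zero.mpr hx)) hz2)
  simpa [hS] using this

end

/-- At a root of unity of odd order, the truncated quadratic series with its denominators cleared
vanishes identically. -/
theorem polySum_eq_zero_of_isPrimitiveRoot {ζ : ℂ} {M : ℕ}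
    (hζ : IsPrimitiveRoot ζ (2 * M + 1)) (w z : ℂ) : polySum M ζ w z = 0 := by
  have hfin : {z : ℂ | z ^ (2 * M + 1) = 1}.Finite := by
    refine (nthRootsFinset (2 * M + 1) (1 : ℂ)).finite_toSet.subset fun z hz => ?_
    simpa [mem_nthRootsFinset] using hz
  -- Generic parameters suffice: a polynomial, first in `z` and then in `w`, that vanishes off a
  -- finite set is zero.
  have step : ∀ x : ℂ, x ≠ 0 → x ^ (2 * M + 1) ≠ 1 → ∀ z, polySum M ζ (x + x⁻¹) z = 0 := by
    intro x hx0 hx z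
    have h0 : polySum M (C ζ) (C (x + x⁻¹)) X = 0 := by
      refine eq_zero_of_infinite_isRoot _ ((hfin.insert 0).infinite_compl.mono fun z hz => ?_)
      simp only [Set.mem_compl_iff, Set.mem_insert_iff, Set.mem_ofPred_eq, not_or] at hz
      have := map_polySum (evalRingHom z) M (C ζ) (C (x + x⁻¹)) X
      simp only [coe_evalRingHom, eval_C, eval_X] at this
      rw [Set.mem_ofPred_eq, IsRoot.def, this, polySum_eq_hypSum_mul,
        hypSum_eq_zero_of_generic hζ hx0 hx hz.1 hz.2, zero_mul]
      exact fun i hi => mul_ne_zero (mul_ne_zero (hζ.one_sub_pow_four_mul_ne_zero i hi)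
        (quadratic_ne_zero_of_generic hζ.pow_eq_one hx0 hx _))
        (one_sub_mul_pow_ne_zero hζ.pow_eq_one hz.2 _)
    have := map_polySum (evalRingHom z) M (C ζ) (C (x + x⁻¹)) X
    rw [h0, map_zero] at this
    simpa using this.symm
  have h0 : polySum M (C ζ) X (C z) = 0 := by
    refine eq_zero_of_infinite_isRoot _ ((hfin.image fun x => x + x⁻¹).infinite_compl.mono
      fun w hw => ?_)
    -- The numbers `(w ± s) / 2` are the roots `x`, `1 / x` of `T ^ 2 - w * T + 1`.
    obtain ⟨s, hs⟩ := IsAlgClosed.exists_pow_nat_eq (w ^ 2 - 4) (n := 2) (by norm_num)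
    have hx : (w + s) / 2 * ((w - s) / 2) = 1 := by linear_combination (-1 / 4) * hs
    have hx0 : (w + s) / 2 ≠ 0 := left_ne_zero_of_mul_eq_one hx
    have hw' : (w + s) / 2 + ((w + s) / 2)⁻¹ = w := by
      rw [inv_eq_of_mul_eq_one_right hx]
      ring
    have := map_polySum (evalRingHom w) M (C ζ) X (C z)
    simp only [coe_evalRingHom, eval_C, eval_X] at this
    rw [Set.mem_ofPred_eq, IsRoot.def, this, ← hw']
    refine step _ hx0 (fun h => hw ⟨_, h, hw'⟩) z
  have := map_polySum (evalRingHom w) M (C ζ) X (C z)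
  simpa [h0] using this.symm

theorem polySum_C_X_X_eq_zero_of_isPrimitiveRoot {ζ : ℂ} {M : ℕ}
    (hζ : IsPrimitiveRoot ζ (2 * M + 1)) :
    polySum M (C (C ζ)) (C X) (X : ℂ[X][X]) = 0 := by
  refine eq_zero_of_infinite_isRoot _ ((Set.infinite_range_of_injective
    (C_injective (R := ℂ))).mono ?_)
  rintro _ ⟨z, rfl⟩
  refine Polynomial.funext fun w => ?_
  have h := map_polySum ((evalRingHom w).comp (evalRingHom (C z))) M (C (C ζ)) (C X) X
  simp only [RingHom.comp_apply, coe_evalRingHom, eval_C, eval_X] at h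
  rw [h, eval_zero, polySum_eq_zero_of_isPrimitiveRoot hζ]

/-! ### Product formulas for the terminating series -/

section

variable {F : Type*} [Field F] {q w : F}

theorem hypTerm_pow_eq_zero {m k : ℕ} (h : m < k) : hypTerm q w (q ^ (4 * m + 1)) k = 0 :=
  prod_eq_zero (mem_range.mpr h) (by simp [ratioNum])

theorem hypSum_self {K : ℕ} : hypSum K q w q = 1 - q := by
  rw [hypSum, sum_eq_single 0]
  · simp [hypTerm]
  · intro k _ hk
    have := hypTerm_pow_eq_zero (q := q) (w := w) (Nat.pos_of_ne_zero hk)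
    rw [mul_zero, zero_add, pow_one] at this
    rw [this, mul_zero]
  · simp

theorem one_sub_pow_ne_zero (hq : ∀ j, 0 < j → q ^ j ≠ 1) {j : ℕ} (hj : 0 < j) : 1 - q ^ j ≠ 0 :=
  sub_ne_zero.mpr (hq j hj).symm

/-- The quadratic summation, terminated by `z = q ^ (4 * m + 1)`. -/
theorem hypSum_pow (hq : ∀ j, 0 < j → q ^ j ≠ 1)
    (hb : ∀ i, 1 + q ^ (8 * i + 8) - w * q ^ (4 * i + 4) ≠ 0) {m K : ℕ}
    (h : m ≤ K) : hypSum K q w (q ^ (4 * m + 1)) = (1 - q) * ∏ j ∈ range m,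
      (1 - q ^ (4 * j + 3)) * (1 - q ^ (4 * j + 5)) /
        (1 + q ^ (8 * j + 8) - w * q ^ (4 * j + 4)) := by
  induction m with
  | zero => simp [hypSum_self]
  | succ m ih =>
    have hz : ∀ i, 1 - q ^ (4 * m + 1) * q ^ (2 * i + 2) ≠ 0 := fun i => by
      rw [← pow_add]
      exact one_sub_pow_ne_zero hq (by omega)
    have := hypSum_shift (w := w) hz K (fun i _ => one_sub_pow_ne_zero hq (by omega))
      (fun i _ => hb i)
    -- The boundary term vanishes because the term of index `K > m` contains `z - q ^ (4 * m + 1)`.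
    rw [hypTerm_pow_eq_zero h, mul_zero, zero_div, add_zero, ih (by omega)] at this
    rw [prod_range_succ, show q ^ (4 * (m + 1) + 1) = q ^ (4 * m + 1) * q ^ 4 by ring]
    have hA : 1 + q ^ 6 * (q ^ (4 * m + 1)) ^ 2 - w * q ^ 3 * q ^ (4 * m + 1) =
      1 + q ^ (8 * m + 8) - w * q ^ (4 * m + 4) := by ring
    rw [hA] at this
    refine mul_left_cancel₀ (hb m) (this.trans ?_)
    have := hb m
    rw [show q ^ (4 * m + 1) * q ^ 2 = q ^ (4 * m + 3) by ring,
      show q ^ (4 * m + 1) * q ^ 4 = q ^ (4 * m + 5) by ring]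
    generalize 1 + q ^ (8 * m + 8) - w * q ^ (4 * m + 4) = D at *
    field_simp

theorem pow_ne_pow_of_lt (hq : ∀ j, 0 < j → q ^ j ≠ 1) {i j : ℕ} (hq0 : q ≠ 0) (h : i < j) : q ^ i ≠ q ^ j := by
  obtain ⟨k, rfl⟩ := Nat.exists_eq_add_of_lt h
  intro h'
  refine hq (k + 1) k.succ_pos (mul_left_cancel₀ (pow_ne_zero i hq0) ?_)
  rw [mul_one, ← pow_add, ← add_assoc, ← h']

theorem quadratic_ne_zero (hq : ∀ j, 0 < j → q ^ j ≠ 1)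
    (hq0 : q ≠ 0) (m i : ℕ) :
    1 + q ^ (8 * i + 8) - (q ^ (4 * m + 1) + (q ^ (4 * m + 1))⁻¹) * q ^ (4 * i + 4) ≠ 0 := by
  have h1 : 1 - q ^ (4 * i + 4 + (4 * m + 1)) ≠ 0 := one_sub_pow_ne_zero hq (by omega)
  have h2 : q ^ (4 * m + 1) - q ^ (4 * i + 4) ≠ 0 := by
    rw [sub_ne_zero]
    rcases lt_or_gt_of_ne (show 4 * m + 1 ≠ 4 * i + 4 by omega) with h | h
    · exact pow_ne_pow_of_lt hq hq0 h
    · exact (pow_ne_pow_of_lt hq hq0 h).symm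
  have h3 := pow_ne_zero (4 * m + 1) hq0
  convert mul_ne_zero (mul_ne_zero h1 h2) (inv_ne_zero h3) using 1
  field_simp
  ring

theorem quadratic_two_ne_zero (hq : ∀ j, 0 < j → q ^ j ≠ 1)
    (i : ℕ) : 1 + q ^ (8 * i + 8) - 2 * q ^ (4 * i + 4) ≠ 0 := by
  convert pow_ne_zero 2 (one_sub_pow_ne_zero hq (show 0 < 4 * i + 4 by omega)) using 1
  ring

/-- For `x = q ^ (4 * m + 1)` the factor `1 - q ^ (2 * K + 1) / x` at `K = 2 * m` kills the boundary
term, leaving a two-term recursion in `z` that starts from `z = q`. The value `z = 1` is not on this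
orbit; `hypSum_quadratic_one` reaches it because both sides, cleared of denominators, are
polynomials in `z` agreeing at infinitely many points. -/
theorem hypSum_quadratic_pow (hq : ∀ j, 0 < j → q ^ j ≠ 1)
    (hq0 : q ≠ 0) (m l : ℕ) :
    hypSum (2 * m) q (q ^ (4 * m + 1) + (q ^ (4 * m + 1))⁻¹) (q ^ (4 * l + 1)) * (q ^ m *
      ∏ j ∈ range m, (1 - q ^ (4 * l + 1) * q ^ (4 * j + 4))) =
    (1 - q ^ (4 * m + 1)) * ∏ j ∈ range m, (q ^ (4 * l + 1) - q ^ (4 * j + 2)) := by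
  induction l with
  | zero =>
    rw [mul_zero, zero_add, pow_one, hypSum_self]
    clear hq
    induction m with
    | zero => simp
    | succ m ih =>
      rw [prod_range_succ, prod_range_succ]
      linear_combination (q * (1 - q ^ (4 * m + 5))) * ih
  | succ l ih =>
    have hz : ∀ i, 1 - q ^ (4 * l + 1) * q ^ (2 * i + 2) ≠ 0 := fun i => by
      rw [← pow_add]
      exact one_sub_pow_ne_zero hq (by omega)
    have hs := hypSum_shift (w := q ^ (4 * m + 1) + (q ^ (4 * m + 1))⁻¹) hz (2 * m)
      (fun i _ => one_sub_pow_ne_zero hq (by omega)) (fun i _ => quadratic_ne_zero hq hq0 m i)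
    have h0 : 1 + q ^ (4 * (2 * m) + 2) - (q ^ (4 * m + 1) + (q ^ (4 * m + 1))⁻¹) *
        q ^ (2 * (2 * m) + 1) = 0 := by
      rw [show 2 * (2 * m) + 1 = 4 * m + 1 by ring, add_mul, inv_mul_cancel₀ (pow_ne_zero _ hq0)]
      ring
    rw [h0, mul_zero, mul_zero, zero_mul, zero_div, add_zero] at hs
    have hA : 1 + q ^ 6 * (q ^ (4 * l + 1)) ^ 2 - (q ^ (4 * m + 1) + (q ^ (4 * m + 1))⁻¹) * q ^ 3 *
        q ^ (4 * l + 1) = 1 + q ^ (8 * l + 8) - (q ^ (4 * m + 1) + (q ^ (4 * m + 1))⁻¹) *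
          q ^ (4 * l + 4) := by ring
    rw [hA] at hs
    have hA' := quadratic_ne_zero hq hq0 m l
    -- The shift by `q ^ 4` moves each product along by one factor, so only end factors change, here
    -- and in `hT`; in `hAq` these end factors recombine into the coefficient of the recursion.
    have hV : ∀ z : F, (∏ j ∈ range m, (z * q ^ 4 - q ^ (4 * j + 2))) * (q ^ (4 * m) - z * q ^ 2) =
        q ^ (4 * m) * (1 - z * q ^ 2) * ∏ j ∈ range m, (z - q ^ (4 * j + 2)) := by
      intro z
      clear hs hA hA' h0 hz ih
      induction m with
      | zero => simp
      | succ m ih =>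
        rw [prod_range_succ, prod_range_succ]
        linear_combination (-(q ^ 2 * (q ^ (4 * m + 4) - z * q ^ 2))) * ih
    have hT : ∀ z : F, (∏ j ∈ range m, (1 - z * q ^ 4 * q ^ (4 * j + 4))) * (1 - z * q ^ 4) =
        (1 - z * q ^ (4 * m + 4)) * ∏ j ∈ range m, (1 - z * q ^ (4 * j + 4)) := by
      intro z
      clear hs hA hA' h0 hz ih hV
      induction m with
      | zero => simp
      | succ m ih =>
        rw [prod_range_succ, prod_range_succ]
        linear_combination (1 - z * q ^ 4 * q ^ (4 * m + 4)) * ih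
    rw [show q ^ (4 * (l + 1) + 1) = q ^ (4 * l + 1) * q ^ 4 by ring]
    have hV := hV (q ^ (4 * l + 1))
    have hT := hT (q ^ (4 * l + 1))
    have hAq : q ^ (4 * m) * (1 + q ^ (8 * l + 8) - (q ^ (4 * m + 1) + (q ^ (4 * m + 1))⁻¹) *
          q ^ (4 * l + 4)) =
        (1 - q ^ (4 * l + 1) * q ^ (4 * m + 4)) * (q ^ (4 * m) - q ^ (4 * l + 1) * q ^ 2) := by
      field_simp
      ring
    have h4 : 1 - q ^ (4 * l + 1) * q ^ 4 ≠ 0 := hz 1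
    refine mul_left_cancel₀ (mul_ne_zero (mul_ne_zero hA' h4) (pow_ne_zero (4 * m) hq0)) ?_
    generalize 1 + q ^ (8 * l + 8) - (q ^ (4 * m + 1) + (q ^ (4 * m + 1))⁻¹) *
          q ^ (4 * l + 4) = A at *
    generalize hypSum (2 * m) q (q ^ (4 * m + 1) + (q ^ (4 * m + 1))⁻¹) = S at *
    generalize q ^ (4 * l + 1) = z at *
    generalize (∏ j ∈ range m, (z * q ^ 4 - q ^ (4 * j + 2))) = V' at *
    generalize (∏ j ∈ range m, (z - q ^ (4 * j + 2))) = V at *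
    generalize (∏ j ∈ range m, (1 - z * q ^ 4 * q ^ (4 * j + 4))) = T' at *
    generalize (∏ j ∈ range m, (1 - z * q ^ (4 * j + 4))) = T at *
    generalize q ^ (4 * m + 4) = x at *
    generalize q ^ (4 * m + 1) = y at *
    generalize q ^ (4 * m) = u at *
    linear_combination (u * q ^ m * T' * (1 - z * q ^ 4)) * hs + (u * q ^ m * (1 - z * q ^ 2) *
      (1 - z * q ^ 4) * S z) * hT + u * (1 - z * q ^ 2) * (1 - z * q ^ 4) * (1 - z * x) * ih -
      (1 - y) * (1 - z * q ^ 4) * (V' * hAq + (1 - z * x) * hV)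

/-- The quadratic summation at `z = 1`, terminated by `x = q ^ (4 * m + 1)`. -/
theorem hypSum_quadratic_one (hq : ∀ j, 0 < j → q ^ j ≠ 1)
    (hq0 : q ≠ 0) (m : ℕ) :
    hypSum (2 * m) q (q ^ (4 * m + 1) + (q ^ (4 * m + 1))⁻¹) 1 * (q ^ m *
      ∏ j ∈ range m, (1 - q ^ (4 * j + 4))) =
    (1 - q ^ (4 * m + 1)) * ∏ j ∈ range m, (1 - q ^ (4 * j + 2)) := by
  set w := q ^ (4 * m + 1) + (q ^ (4 * m + 1))⁻¹ with hw
  have hden : ∀ z : F, (∀ i, 1 - z * q ^ (2 * i + 2) ≠ 0) → ∀ i, ratioDen q w z i ≠ 0 :=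
    fun z hz i => mul_ne_zero (mul_ne_zero (one_sub_pow_ne_zero hq (by omega))
      (quadratic_ne_zero hq hq0 m i)) (hz i)
  have hpoly : polySum (2 * m) (C q) (C w) X *
      (C q ^ m * ∏ j ∈ range m, (1 - X * C q ^ (4 * j + 4))) -
      (1 - C q ^ (4 * m + 1)) * (∏ j ∈ range m, (X - C q ^ (4 * j + 2))) *
        ∏ i ∈ range (2 * m), ratioDen (C q) (C w) X i = 0 := by
    have hinj : Function.Injective fun l : ℕ => q ^ (4 * l + 1) := by
      intro a b hab
      by_contra hne
      rcases lt_or_gt_of_ne hne with h | h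
      · exact pow_ne_pow_of_lt hq hq0 (show 4 * a + 1 < 4 * b + 1 by omega) hab
      · exact pow_ne_pow_of_lt hq hq0 (show 4 * b + 1 < 4 * a + 1 by omega) hab.symm
    refine eq_zero_of_infinite_isRoot _ ((Set.infinite_range_of_injective hinj).mono ?_)
    rintro _ ⟨l, rfl⟩
    have h := map_polySum (evalRingHom (q ^ (4 * l + 1))) (2 * m) (C q) (C w) X
    simp only [coe_evalRingHom, eval_C, eval_X] at h
    have hz : ∀ i, 1 - q ^ (4 * l + 1) * q ^ (2 * i + 2) ≠ 0 := fun i => by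
      rw [← pow_add]
      exact one_sub_pow_ne_zero hq (by omega)
    rw [Set.mem_ofPred_eq, IsRoot.def, eval_sub, eval_mul, h,
      polySum_eq_hypSum_mul fun i _ => hden _ hz i, sub_eq_zero]
    simp only [eval_mul, eval_prod, eval_pow, eval_C, eval_sub, eval_one, eval_X, ratioDen,
      eval_add]
    linear_combination (∏ i ∈ range (2 * m), ((1 - q ^ (4 * i + 4)) *
      (1 + q ^ (8 * i + 8) - w * q ^ (4 * i + 4)) * (1 - q ^ (4 * l + 1) * q ^ (2 * i + 2)))) *
      hypSum_quadratic_pow hq hq0 m l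
  have h := congrArg (eval 1) hpoly
  have h' := map_polySum (evalRingHom 1) (2 * m) (C q) (C w) X
  simp only [coe_evalRingHom, eval_C, eval_X] at h'
  have hz : ∀ i, 1 - 1 * q ^ (2 * i + 2) ≠ 0 := fun i => by
    rw [one_mul]
    exact one_sub_pow_ne_zero hq (by omega)
  rw [eval_sub, eval_mul, h', polySum_eq_hypSum_mul fun i _ => hden _ hz i] at h
  simp only [eval_mul, eval_prod, eval_pow, eval_C, eval_sub, eval_one, eval_X, ratioDen,
    eval_add, eval_zero, one_mul] at h
  have hD : ∏ i ∈ range (2 * m), ratioDen q w 1 i ≠ 0 :=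
    prod_ne_zero_iff.mpr fun i _ => hden 1 hz i
  simp only [ratioDen, one_mul] at hD
  exact mul_right_cancel₀ hD (by linear_combination h)

end

/-! ### Regularity, values at `ζ`, and divisibility of numerators -/

/-- The local ring of rational functions over `ℚ` that are regular at the complex number `ζ`. -/
def regularAt (ζ : ℂ) : Subring (RatFunc ℚ) where
  carrier := {r | eval₂ (algebraMap ℚ ℂ) ζ r.denom ≠ 0}
  mul_mem' {r s} hr hs h := by
    have := eval₂_eq_zero_of_dvd_of_eval₂_eq_zero (algebraMap ℚ ℂ) ζ (RatFunc.denom_mul_dvd r s) h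
    rw [eval₂_mul] at this
    exact (mul_ne_zero hr hs) this
  one_mem' := by simp
  add_mem' {r s} hr hs h := by
    have := eval₂_eq_zero_of_dvd_of_eval₂_eq_zero (algebraMap ℚ ℂ) ζ (RatFunc.denom_add_dvd r s) h
    rw [eval₂_mul] at this
    exact (mul_ne_zero hr hs) this
  zero_mem' := by simp
  neg_mem' {r} hr h := by
    have h1 : (-r).denom ∣ (algebraMap ℚ[X] (RatFunc ℚ) (-1)).denom * r.denom := by
      simpa only [map_neg, map_one, neg_one_mul] using
        RatFunc.denom_mul_dvd (algebraMap ℚ[X] (RatFunc ℚ) (-1)) r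
    rw [RatFunc.denom_algebraMap, one_mul] at h1
    exact hr (eval₂_eq_zero_of_dvd_of_eval₂_eq_zero _ _ h1 h)

/-- Evaluation at `ζ` of the rational functions regular at `ζ`. -/
noncomputable def evalAt (ζ : ℂ) : regularAt ζ →+* ℂ where
  toFun r := RatFunc.eval (algebraMap ℚ ℂ) ζ (r : RatFunc ℚ)
  map_one' := RatFunc.eval_one _ _
  map_mul' r s := RatFunc.eval_mul _ _ r.2 s.2
  map_zero' := RatFunc.eval_zero _ _
  map_add' r s := RatFunc.eval_add _ _ r.2 s.2

/-- The rational function `r` is regular at `ζ`, with value `c`. -/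
def HasValue (ζ : ℂ) (r : RatFunc ℚ) (c : ℂ) : Prop :=
  ∃ h : r ∈ regularAt ζ, evalAt ζ ⟨r, h⟩ = c

namespace HasValue

variable {ζ : ℂ} {r s : RatFunc ℚ} {c d : ℂ}

theorem mk_evalAt (r : regularAt ζ) : HasValue ζ r (evalAt ζ r) := ⟨r.2, rfl⟩

theorem add (hr : HasValue ζ r c) (hs : HasValue ζ s d) : HasValue ζ (r + s) (c + d) := by
  obtain ⟨hr, rfl⟩ := hr
  obtain ⟨hs, rfl⟩ := hs
  exact ⟨add_mem hr hs, map_add (evalAt ζ) ⟨r, hr⟩ ⟨s, hs⟩⟩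

theorem sub (hr : HasValue ζ r c) (hs : HasValue ζ s d) : HasValue ζ (r - s) (c - d) := by
  obtain ⟨hr, rfl⟩ := hr
  obtain ⟨hs, rfl⟩ := hs
  exact ⟨sub_mem hr hs, map_sub (evalAt ζ) ⟨r, hr⟩ ⟨s, hs⟩⟩

theorem mul (hr : HasValue ζ r c) (hs : HasValue ζ s d) : HasValue ζ (r * s) (c * d) := by
  obtain ⟨hr, rfl⟩ := hr
  obtain ⟨hs, rfl⟩ := hs
  exact ⟨mul_mem hr hs, map_mul (evalAt ζ) ⟨r, hr⟩ ⟨s, hs⟩⟩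

theorem pow (hr : HasValue ζ r c) (j : ℕ) : HasValue ζ (r ^ j) (c ^ j) := by
  obtain ⟨hr, rfl⟩ := hr
  exact ⟨pow_mem hr j, map_pow (evalAt ζ) ⟨r, hr⟩ j⟩

protected theorem one : HasValue ζ 1 1 := ⟨one_mem _, map_one (evalAt ζ)⟩

protected theorem zero : HasValue ζ 0 0 := ⟨zero_mem _, map_zero (evalAt ζ)⟩

protected theorem algebraMap (p : ℚ[X]) :
    HasValue ζ (algebraMap ℚ[X] (RatFunc ℚ) p) (aeval ζ p) :=
  ⟨by simp [regularAt], by simp [evalAt, aeval_def]⟩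

protected theorem X : HasValue ζ RatFunc.X ζ := by
  simpa using HasValue.algebraMap (ζ := ζ) (X : ℚ[X])

protected theorem ratCast (a : ℚ) : HasValue ζ (a : RatFunc ℚ) (a : ℂ) := by
  simpa using HasValue.algebraMap (ζ := ζ) (C a)

theorem inv (hr : HasValue ζ r c) (hc : c ≠ 0) : HasValue ζ r⁻¹ c⁻¹ := by
  obtain ⟨hr, rfl⟩ := hr
  have hr0 : r ≠ 0 := by
    rintro rfl
    exact hc (map_zero (evalAt ζ))
  have hmem : r⁻¹ ∈ regularAt ζ := fun h => hc (div_eq_zero_iff.mpr (Or.inl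
    (eval₂_eq_zero_of_dvd_of_eval₂_eq_zero _ _ (RatFunc.denom_inv_dvd hr0) h)))
  refine ⟨hmem, eq_inv_of_mul_eq_one_left ?_⟩
  rw [← map_mul, ← map_one (evalAt ζ)]
  congr 1
  exact Subtype.ext (inv_mul_cancel₀ hr0)

theorem div (hr : HasValue ζ r c) (hs : HasValue ζ s d) (hd : d ≠ 0) :
    HasValue ζ (r / s) (c / d) := by
  rw [div_eq_mul_inv, div_eq_mul_inv]
  exact hr.mul (hs.inv hd)

theorem sum {ι : Type*} (T : Finset ι) {f : ι → RatFunc ℚ} {g : ι → ℂ}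
    (h : ∀ i ∈ T, HasValue ζ (f i) (g i)) : HasValue ζ (∑ i ∈ T, f i) (∑ i ∈ T, g i) := by
  classical
  induction T using Finset.induction_on with
  | empty => simpa using HasValue.zero
  | insert a T ha ih =>
    rw [sum_insert ha, sum_insert ha]
    exact (h a (mem_insert_self a T)).add (ih fun i hi => h i (mem_insert_of_mem hi))

theorem prod {ι : Type*} (T : Finset ι) {f : ι → RatFunc ℚ} {g : ι → ℂ}
    (h : ∀ i ∈ T, HasValue ζ (f i) (g i)) : HasValue ζ (∏ i ∈ T, f i) (∏ i ∈ T, g i) := by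
  classical
  induction T using Finset.induction_on with
  | empty => simpa using HasValue.one
  | insert a T ha ih =>
    rw [prod_insert ha, prod_insert ha]
    exact (h a (mem_insert_self a T)).mul (ih fun i hi => h i (mem_insert_of_mem hi))

theorem unique (hr : HasValue ζ r c) (hr' : HasValue ζ r d) : c = d := by
  obtain ⟨_, rfl⟩ := hr
  obtain ⟨_, rfl⟩ := hr'
  rfl

end HasValue

variable {ζ : ℂ} {d : ℕ}

theorem _root_.IsPrimitiveRoot.cyclotomic_dvd (hd : 0 < d) (hζ : IsPrimitiveRoot ζ d) {p : ℚ[X]}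
    (hp : aeval ζ p = 0) : cyclotomic d ℚ ∣ p := by
  rw [cyclotomic_eq_minpoly_rat hζ hd]
  exact minpoly.dvd ℚ ζ hp

theorem HasValue.exists_eq_cyclotomic_mul (hd : 0 < d) (hζ : IsPrimitiveRoot ζ d) {r : RatFunc ℚ}
    (hr : HasValue ζ r 0) :
    ∃ s ∈ regularAt ζ, r = algebraMap ℚ[X] (RatFunc ℚ) (cyclotomic d ℚ) * s := by
  obtain ⟨hr, hr'⟩ := hr
  have h0 : aeval ζ r.num = 0 := (div_eq_zero_iff.mp hr').resolve_right hr
  obtain ⟨p, hp⟩ := hζ.cyclotomic_dvd hd h0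
  refine ⟨algebraMap _ _ p / algebraMap _ _ r.denom, ?_, ?_⟩
  · exact fun h => hr (eval₂_eq_zero_of_dvd_of_eval₂_eq_zero _ _ (RatFunc.denom_div_dvd _ _) h)
  · rw [← mul_div_assoc, ← map_mul, ← hp, RatFunc.num_div_denom]

/-- The cyclotomic polynomial is irreducible and cannot divide the denominator of `s`, which is
nonzero at `ζ`; so no factor is lost in lowest terms. -/
theorem cyclotomic_pow_dvd_num (hd : 0 < d) (hζ : IsPrimitiveRoot ζ d) {r s : RatFunc ℚ}
    (hs : s ∈ regularAt ζ) {e : ℕ}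
    (h : r = algebraMap ℚ[X] (RatFunc ℚ) (cyclotomic d ℚ) ^ e * s) :
    cyclotomic d ℚ ^ e ∣ r.num := by
  have hirr : Irreducible (cyclotomic d ℚ) := cyclotomic.irreducible_rat hd
  have hcop : IsCoprime (cyclotomic d ℚ ^ e) s.denom := by
    refine IsCoprime.pow_left ((hirr.coprime_iff_not_dvd).mpr fun h' => hs ?_)
    refine eval₂_eq_zero_of_dvd_of_eval₂_eq_zero _ _ h' ?_
    rw [cyclotomic_eq_minpoly_rat hζ hd]
    exact minpoly.aeval ℚ ζ
  have heq : r.num * s.denom = cyclotomic d ℚ ^ e * s.num * r.denom := by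
    apply RatFunc.algebraMap_injective ℚ
    have h1 := RatFunc.num_div_denom r
    have h2 := RatFunc.num_div_denom s
    have h3 := RatFunc.algebraMap_ne_zero r.denom_ne_zero
    have h4 := RatFunc.algebraMap_ne_zero s.denom_ne_zero
    rw [div_eq_iff h3] at h1
    rw [div_eq_iff h4] at h2
    simp only [map_mul, map_pow]
    rw [h1, h2, h]
    ring
  refine hcop.dvd_of_dvd_mul_right ⟨s.num * r.denom, by rw [heq, mul_assoc]⟩

theorem HasValue.cyclotomic_dvd_num (hd : 0 < d) (hζ : IsPrimitiveRoot ζ d) {r : RatFunc ℚ}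
    (hr : HasValue ζ r 0) : cyclotomic d ℚ ∣ r.num := by
  obtain ⟨s, hs, h⟩ := hr.exists_eq_cyclotomic_mul hd hζ
  simpa using cyclotomic_pow_dvd_num hd hζ hs (e := 1) (by simpa using h)

/-! ### The mixed second difference -/

/-- This is the second difference of `N(w, z) / (D(w) * E(z))`, multiplied out so that it makes
sense in `O`. Since the denominator separates, `w₁ - w₂` can be extracted coefficient by coefficient
in `z`, and then `z₁ - z₂` from the quotient. -/
theorem dvd_mixed_difference {O : Type*} [CommRing O] (N : O[X][X]) (D E : O[X])
    (w₁ w₂ z₁ z₂ : O) : (w₁ - w₂) * (z₁ - z₂) ∣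
      N.evalEval w₁ z₁ * (D.eval w₂ * E.eval z₂) - N.evalEval w₂ z₁ * (D.eval w₁ * E.eval z₂) -
      N.evalEval w₁ z₂ * (D.eval w₂ * E.eval z₁) + N.evalEval w₂ z₂ * (D.eval w₁ * E.eval z₁) := by
  have cross : ∀ (p r : O[X]) (a b : O), a - b ∣ p.eval a * r.eval b - p.eval b * r.eval a := by
    intro p r a b
    obtain ⟨s, hs⟩ := sub_dvd_eval_sub a b p
    obtain ⟨t, ht⟩ := sub_dvd_eval_sub a b r
    exact ⟨s * r.eval b - p.eval b * t, by linear_combination r.eval b * hs - p.eval b * ht⟩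
  have hG : C (w₁ - w₂) ∣ N.map (evalRingHom w₁) * C (D.eval w₂) -
      N.map (evalRingHom w₂) * C (D.eval w₁) := by
    rw [C_dvd_iff_dvd_coeff]
    intro i
    simpa using cross (N.coeff i) D w₁ w₂
  obtain ⟨G, hG⟩ := hG
  obtain ⟨t, ht⟩ := cross G E z₁ z₂
  refine ⟨t, ?_⟩
  have h : ∀ z, N.evalEval w₁ z * D.eval w₂ - N.evalEval w₂ z * D.eval w₁ =
      (w₁ - w₂) * G.eval z := by
    intro z
    have := congrArg (eval z) hG
    simpa [map_evalRingHom_eval] using this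
  linear_combination E.eval z₂ * h z₁ - E.eval z₁ * h z₂ + (w₁ - w₂) * ht

/-- With denominators cleared, the truncated quadratic series is divisible by a cyclotomic
polynomial, coefficient by coefficient. -/
theorem cyclotomic_dvd_polySum (M : ℕ) : C (C (cyclotomic (2 * M + 1) ℚ)) ∣
    polySum M (C (C X)) (C X) (X : ℚ[X][X][X]) := by
  have hζ := Complex.isPrimitiveRoot_exp (2 * M + 1) (by omega)
  set ζ := Complex.exp (2 * Real.pi * Complex.I / ((2 * M + 1 : ℕ) : ℂ))
  have h := map_polySum (mapRingHom (mapRingHom (aeval (R := ℚ) ζ).toRingHom)) M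
    (C (C X)) (C X) (X : ℚ[X][X][X])
  simp only [coe_mapRingHom, map_C, map_X, AlgHom.toRingHom_eq_coe, RingHom.coe_coe, aeval_X,
    polySum_C_X_X_eq_zero_of_isPrimitiveRoot hζ] at h
  rw [C_dvd_iff_dvd_coeff]
  intro i
  rw [C_dvd_iff_dvd_coeff]
  intro j
  refine hζ.cyclotomic_dvd (by omega) ?_
  have := congrArg (fun p => (p.coeff i).coeff j) h
  simpa using this

theorem hasValue_ratioDen {ζ : ℂ} {w z : RatFunc ℚ} (hw : HasValue ζ w 2) (hz : HasValue ζ z 1)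
    (i : ℕ) : HasValue ζ (ratioDen RatFunc.X w z i) (ratioDen ζ 2 1 i) :=
  have hX := HasValue.X (ζ := ζ)
  ((HasValue.one.sub (hX.pow _)).mul ((HasValue.one.add (hX.pow _)).sub (hw.mul (hX.pow _)))).mul
    (HasValue.one.sub (hz.mul (hX.pow _)))

theorem ratioDen_two_one_ne_zero {ζ : ℂ} {M : ℕ} (hζ : IsPrimitiveRoot ζ (2 * M + 1)) {i : ℕ}
    (hi : i < 2 * M) : ratioDen ζ 2 1 i ≠ 0 := by
  have h2 : Nat.Coprime (2 * M + 1) 2 := by simp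
  have hdvd : ¬ 2 * M + 1 ∣ i + 1 := fun h => by
    have := Nat.le_of_dvd (by omega) h
    omega
  have h1 : 1 - ζ ^ (4 * i + 4) ≠ 0 := by
    intro h
    have h1 := (hζ.pow_eq_one_iff_dvd _).mp (sub_eq_zero.mp h).symm
    rw [show 4 * i + 4 = 2 ^ 2 * (i + 1) by ring] at h1
    exact hdvd ((h2.pow_right 2).dvd_of_dvd_mul_left h1)
  refine mul_ne_zero (mul_ne_zero h1 ?_) ?_
  · convert pow_ne_zero 2 h1 using 1
    ring
  · rw [one_mul]
    intro h
    have h1 := (hζ.pow_eq_one_iff_dvd _).mp (sub_eq_zero.mp h).symm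
    rw [show 2 * i + 2 = 2 * (i + 1) by ring] at h1
    exact hdvd (h2.dvd_of_dvd_mul_left h1)

theorem HasValue.ne_zero {ζ : ℂ} {r : RatFunc ℚ} {c : ℂ} (h : HasValue ζ r c) (hc : c ≠ 0) :
    r ≠ 0 := by
  rintro rfl
  exact hc (h.unique HasValue.zero)

/-- With `u = q ^ (2 * M + 1)`, the parameter `u + 1 / u` differs from `2` by `(1 - u) ^ 2 / u`, and
`z` moves by `1 - u`: this is the cube. The extra cyclotomic factor comes from
`cyclotomic_dvd_polySum`. All denominators are units at `ζ`. -/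
theorem hypSum_mixed_difference {ζ : ℂ} {M : ℕ} (hζ : IsPrimitiveRoot ζ (2 * M + 1))
    {q : RatFunc ℚ} (hq : q = RatFunc.X) : ∃ s ∈ regularAt ζ,
    hypSum M q 2 1 - hypSum M q (q ^ (2 * M + 1) + (q ^ (2 * M + 1))⁻¹) 1 -
      hypSum M q 2 (q ^ (2 * M + 1)) +
      hypSum M q (q ^ (2 * M + 1) + (q ^ (2 * M + 1))⁻¹) (q ^ (2 * M + 1)) =
    algebraMap ℚ[X] (RatFunc ℚ) (cyclotomic (2 * M + 1) ℚ) * (1 - q ^ (2 * M + 1)) ^ 3 * s := by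
  have hX : HasValue ζ q ζ := hq ▸ HasValue.X
  have hq0 : q ≠ 0 := hq ▸ RatFunc.X_ne_zero
  obtain ⟨N, hN⟩ := cyclotomic_dvd_polySum M
  have hz2 : HasValue ζ (q ^ (2 * M + 1)) 1 := hζ.pow_eq_one ▸ hX.pow (2 * M + 1)
  have hw2 : HasValue ζ (q ^ (2 * M + 1) + (q ^ (2 * M + 1))⁻¹) 2 := by
    convert hz2.add (hz2.inv one_ne_zero) using 1
    norm_num
  have hw1 : HasValue ζ 2 2 := by simpa using HasValue.ratCast (ζ := ζ) 2
  have hz1 : HasValue ζ 1 1 := HasValue.one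
  set w₂ := q ^ (2 * M + 1) + (q ^ (2 * M + 1))⁻¹ with hw₂
  set z₂ := q ^ (2 * M + 1) with hz₂
  let ψ : ℚ[X] →+* regularAt ζ := (algebraMap ℚ[X] (RatFunc ℚ)).codRestrict (regularAt ζ)
    fun p => (HasValue.algebraMap p).1
  let x : regularAt ζ := ⟨q, hX.1⟩
  have hψ : ψ X = x := Subtype.ext (by simp [ψ, x, hq])
  let D : (regularAt ζ)[X] := ∏ i ∈ range M, (1 + C x ^ (8 * i + 8) - X * C x ^ (4 * i + 4))
  let E : (regularAt ζ)[X] := ∏ i ∈ range M, (1 - X * C x ^ (2 * i + 2))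
  let N' : (regularAt ζ)[X][X] := N.map (mapRingHom ψ)
  have hval : ∀ w z : regularAt ζ, polySum M q w z =
      algebraMap ℚ[X] (RatFunc ℚ) (cyclotomic (2 * M + 1) ℚ) * (N'.evalEval w z : regularAt ζ) := by
    intro w z
    have h1 := congrArg (fun p => (p.map (mapRingHom ψ)).evalEval w z) hN
    have h2 := map_polySum (((evalRingHom w).comp (evalRingHom (C z))).comp
      (mapRingHom (mapRingHom ψ))) M
      (C (C X)) (C X) (X : ℚ[X][X][X])
    simp only [RingHom.comp_apply, coe_mapRingHom, map_C, map_X, hψ, coe_evalRingHom, eval_C,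
      eval_X] at h2
    replace h2 : evalEval w z _ = _ := h2
    simp only [h2, Polynomial.map_mul, evalEval_mul, map_C, coe_mapRingHom, evalEval_C,
      eval_C] at h1
    have h3 := congrArg (regularAt ζ).subtype h1
    rw [map_polySum, map_mul] at h3
    exact h3
  have hden : ∀ w z : regularAt ζ, ∏ i ∈ range M, ratioDen q (w : RatFunc ℚ) z i =
      (∏ i ∈ range M, (1 - q ^ (4 * i + 4))) * (D.eval w : regularAt ζ) *
        (E.eval z : regularAt ζ) := by
    intro w z
    simp only [ratioDen, prod_mul_distrib, D, E, eval_prod, eval_add, eval_sub, eval_mul, eval_pow,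
      eval_C, eval_X, eval_one, SubmonoidClass.coe_finsetProd]
    simp [x]
  have hnz : ∀ w z : regularAt ζ, HasValue ζ w 2 → HasValue ζ z 1 →
      ∃ s ∈ regularAt ζ, s * ∏ i ∈ range M, ratioDen q (w : RatFunc ℚ) z i = 1 ∧
        polySum M q w z = hypSum M q w z * ∏ i ∈ range M, ratioDen q (w : RatFunc ℚ) z i := by
    intro w z hw hz
    have h1 : ∀ i, HasValue ζ (ratioDen q w z i) (ratioDen ζ 2 1 i) :=
      fun i => hq ▸ hasValue_ratioDen hw hz i
    have h2 := HasValue.prod (range M) (fun i _ => h1 i)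
    have h3 : ∏ i ∈ range M, ratioDen ζ 2 1 i ≠ 0 :=
      prod_ne_zero_iff.mpr fun i hi => ratioDen_two_one_ne_zero hζ
      ((mem_range.mp hi).trans_le (by omega))
    exact ⟨_, (h2.inv h3).1, inv_mul_cancel₀ (h2.ne_zero h3), polySum_eq_hypSum_mul
      fun i hi => (h1 i).ne_zero (ratioDen_two_one_ne_zero hζ (by omega))⟩
  let W₁ : regularAt ζ := ⟨2, hw1.1⟩
  let W₂ : regularAt ζ := ⟨w₂, hw2.1⟩
  let Z₁ : regularAt ζ := ⟨1, hz1.1⟩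
  let Z₂ : regularAt ζ := ⟨z₂, hz2.1⟩
  obtain ⟨t, ht⟩ := dvd_mixed_difference N' D E W₁ W₂ Z₁ Z₂
  replace ht := congrArg (regularAt ζ).subtype ht
  simp only [map_sub, map_add, map_mul, Subring.subtype_apply] at ht
  obtain ⟨s11, hs11, e11, f11⟩ := hnz W₁ Z₁ hw1 hz1
  obtain ⟨s21, hs21, e21, f21⟩ := hnz W₂ Z₁ hw2 hz1
  obtain ⟨s12, hs12, e12, f12⟩ := hnz W₁ Z₂ hw1 hz2
  obtain ⟨s22, hs22, e22, f22⟩ := hnz W₂ Z₂ hw2 hz2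
  rw [hval, hden] at f11 f21 f12 f22
  rw [hden] at e11 e21 e12 e22
  have hz₂0 : z₂ ≠ 0 := pow_ne_zero _ hq0
  have hinv : z₂⁻¹ ∈ regularAt ζ := (hz2.inv one_ne_zero).1
  have hww : (W₁ : RatFunc ℚ) - W₂ = - (1 - z₂) ^ 2 * z₂⁻¹ := by
    simp only [W₁, W₂, hw₂]
    field_simp
    ring
  rw [hww] at ht
  have hD0 : (∏ i ∈ range M, (1 - q ^ (4 * i + 4))) ∈ regularAt ζ :=
    prod_mem fun i _ => sub_mem (one_mem _) (pow_mem hX.1 _)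
  refine ⟨- (s11 * s22 * z₂⁻¹ * t * (∏ i ∈ range M, (1 - q ^ (4 * i + 4)))),
    neg_mem (mul_mem (mul_mem (mul_mem (mul_mem hs11 hs22) hinv) t.2) hD0), ?_⟩
  change hypSum M q W₁ Z₁ - hypSum M q W₂ Z₁ - hypSum M q W₁ Z₂ + hypSum M q W₂ Z₂ = _
  have hzz : (Z₁ : RatFunc ℚ) - Z₂ = 1 - z₂ := rfl
  rw [hzz] at ht
  generalize hypSum M q W₁ Z₁ = S11 at *
  generalize hypSum M q W₂ Z₁ = S21 at *
  generalize hypSum M q W₁ Z₂ = S12 at *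
  generalize hypSum M q W₂ Z₂ = S22 at *
  generalize algebraMap ℚ[X] (RatFunc ℚ) (cyclotomic (2 * M + 1) ℚ) = Φ at *
  generalize ((N'.evalEval W₁ Z₁ : regularAt ζ) : RatFunc ℚ) = N11 at *
  generalize ((N'.evalEval W₂ Z₁ : regularAt ζ) : RatFunc ℚ) = N21 at *
  generalize ((N'.evalEval W₁ Z₂ : regularAt ζ) : RatFunc ℚ) = N12 at *
  generalize ((N'.evalEval W₂ Z₂ : regularAt ζ) : RatFunc ℚ) = N22 at *
  generalize ((D.eval W₁ : regularAt ζ) : RatFunc ℚ) = D1 at *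
  generalize ((D.eval W₂ : regularAt ζ) : RatFunc ℚ) = D2 at *
  generalize ((E.eval Z₁ : regularAt ζ) : RatFunc ℚ) = E1 at *
  generalize ((E.eval Z₂ : regularAt ζ) : RatFunc ℚ) = E2 at *
  generalize (∏ i ∈ range M, (1 - q ^ (4 * i + 4))) = D0 at *
  generalize (t : RatFunc ℚ) = t' at *
  generalize z₂⁻¹ = y at *
  have hD0' : D0 ≠ 0 := fun h => by simp [h] at e11
  have hD1' : D1 ≠ 0 := fun h => by simp [h] at e11
  have hE1' : E1 ≠ 0 := fun h => by simp [h] at e11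
  have hD2' : D2 ≠ 0 := fun h => by simp [h] at e22
  have hE2' : E2 ≠ 0 := fun h => by simp [h] at e22
  rw [← eq_div_iff (mul_ne_zero (mul_ne_zero hD0' hD1') hE1')] at e11
  rw [← eq_div_iff (mul_ne_zero (mul_ne_zero hD0' hD2') hE2')] at e22
  rw [← div_eq_iff (mul_ne_zero (mul_ne_zero hD0' ‹_›) ‹_›)] at f11 f21 f12 f22
  rw [← f11, ← f21, ← f12, ← f22, e11, e22]
  field_simp
  linear_combination Φ * ht

/-! ### Sums and products over roots of unity -/

theorem one_sub_sq_mul_sum_mul_pow {R : Type*} [CommRing R] (x : R) (n : ℕ) :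
    (1 - x) ^ 2 * ∑ k ∈ range (n + 1), (k : R) * x ^ k =
      x * (1 - (n + 1) * x ^ n + n * x ^ (n + 1)) := by
  induction n with
  | zero => simp
  | succ n ih =>
    rw [sum_range_succ, mul_add, ih]
    push_cast
    ring

theorem one_sub_cube_mul_sum {R : Type*} [CommRing R] (x : R) (n : ℕ) :
    (1 - x) ^ 3 * ∑ k ∈ range n, (k : R) * (n - k) * x ^ k =
      n * x * (1 - x) * (1 + x ^ n) - x * (1 + x) * (1 - x ^ n) := by
  induction n with
  | zero => simp
  | succ n ih =>
    have h : ∑ k ∈ range (n + 1), (k : R) * ((n + 1 : ℕ) - k) * x ^ k =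
        ∑ k ∈ range n, (k : R) * (n - k) * x ^ k + ∑ k ∈ range (n + 1), (k : R) * x ^ k := by
      have h' : ∑ k ∈ range n, (k : R) * (n - k) * x ^ k =
          ∑ k ∈ range (n + 1), (k : R) * (n - k) * x ^ k := by simp [sum_range_succ]
      rw [h', ← sum_add_distrib]
      refine sum_congr rfl fun k _ => ?_
      push_cast
      ring
    rw [h, mul_add, ih]
    have := one_sub_sq_mul_sum_mul_pow x n
    push_cast
    linear_combination (1 - x) * this

theorem sum_mul_sub {L : Type*} [Field L] [CharZero L] (n : ℕ) :
    ∑ k ∈ range n, (k : L) * (n - k) = n * ((n : L) ^ 2 - 1) / 6 := by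
  have h1 : ∀ n : ℕ, ∑ k ∈ range n, (k : L) = n * (n - 1) / 2 := by
    intro n
    induction n with
    | zero => simp
    | succ n ih => rw [sum_range_succ, ih]; push_cast; ring
  have h2 : ∀ n : ℕ, ∑ k ∈ range n, (k : L) ^ 2 = n * (n - 1) * (2 * n - 1) / 6 := by
    intro n
    induction n with
    | zero => simp
    | succ n ih => rw [sum_range_succ, ih]; push_cast; ring
  have : ∀ k ∈ range n, (k : L) * (n - k) = n * k - (k : L) ^ 2 := fun k _ => by ring
  rw [sum_congr rfl this, sum_sub_distrib, ← mul_sum, h1, h2]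
  ring

/-- The sum of `ζ ^ i / (1 - ζ ^ i) ^ 2` over the nontrivial powers of a primitive `n`-th root of
unity. -/
theorem sum_pow_div_one_sub_pow_sq {L : Type*} [Field L] [CharZero L] {ζ : L} {n : ℕ}
    (hζ : IsPrimitiveRoot ζ (n + 1)) :
    ∑ i ∈ range n, ζ ^ (i + 1) / (1 - ζ ^ (i + 1)) ^ 2 = -(((n : L) + 1) ^ 2 - 1) / 12 := by
  have hn0 : (n : L) + 1 ≠ 0 := by exact_mod_cast n.succ_ne_zero
  -- For `N = n + 1` and `x ^ N = 1`, `x ≠ 1`, the weights `k * (N - k)` linearise the summand: `∑ k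
  -- * (N - k) * x ^ k = 2 * N * x / (1 - x) ^ 2`.
  have h1 : ∀ i ∈ range n, ∑ k ∈ range (n + 1), (k : L) * ((n + 1 : ℕ) - k) * (ζ ^ (i + 1)) ^ k =
      2 * ((n : L) + 1) * (ζ ^ (i + 1) / (1 - ζ ^ (i + 1)) ^ 2) := by
    intro i hi
    have hne : 1 - ζ ^ (i + 1) ≠ 0 := sub_ne_zero.mpr
      (hζ.pow_ne_one_of_pos_of_lt (by omega) (by simp at hi; omega)).symm
    have := one_sub_cube_mul_sum (ζ ^ (i + 1)) (n + 1)
    rw [← pow_mul, mul_comm (i + 1), pow_mul ζ (n + 1), hζ.pow_eq_one, one_pow] at this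
    refine mul_left_cancel₀ (pow_ne_zero 3 hne) (this.trans ?_)
    push_cast
    field_simp
    ring
  -- By orthogonality only `k = 0` could survive, and its weight is zero; so the nontrivial roots
  -- contribute minus the value at `x = 1`.
  have h2 : ∑ i ∈ range (n + 1), ∑ k ∈ range (n + 1),
      (k : L) * ((n + 1 : ℕ) - k) * (ζ ^ i) ^ k = 0 := by
    rw [sum_comm]
    refine sum_eq_zero fun k hk => ?_
    rw [← mul_sum]
    rcases Nat.eq_zero_or_pos k with rfl | hk0
    · simp
    · have hne : ζ ^ k ≠ 1 := hζ.pow_ne_one_of_pos_of_lt hk0.ne' (by simpa using hk)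
      have : ∑ i ∈ range (n + 1), (ζ ^ i) ^ k = ∑ i ∈ range (n + 1), (ζ ^ k) ^ i :=
        sum_congr rfl fun i _ => by rw [← pow_mul, ← pow_mul, mul_comm]
      rw [this, geom_sum_eq hne, ← pow_mul, mul_comm k, pow_mul, hζ.pow_eq_one, one_pow, sub_self,
        zero_div, mul_zero]
  rw [sum_range_succ', sum_congr rfl h1, ← mul_sum] at h2
  simp only [pow_zero, one_pow, mul_one] at h2
  rw [sum_mul_sub] at h2
  push_cast at h2
  refine mul_left_cancel₀ (mul_ne_zero two_ne_zero hn0) ?_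
  linear_combination h2

section

variable {L : Type*} [Field L] {ζ : L} {m : ℕ}

theorem sum_even_odd {L : Type*} [AddCommMonoid L] (f : ℕ → L) (m : ℕ) :
    ∑ i ∈ range (2 * m), f i = ∑ i ∈ range m, f (2 * i) + ∑ i ∈ range m, f (2 * i + 1) := by
  induction m with
  | zero => simp
  | succ m ih =>
    rw [show 2 * (m + 1) = 2 * m + 1 + 1 by ring, sum_range_succ, sum_range_succ, ih,
      sum_range_succ, sum_range_succ]
    abel

theorem one_sub_pow_ne_zero_of_lt {n : ℕ} (hζ : IsPrimitiveRoot ζ n) {j : ℕ} (h0 : 0 < j)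
    (h : j < n) : 1 - ζ ^ j ≠ 0 :=
  sub_ne_zero.mpr (hζ.pow_ne_one_of_pos_of_lt h0.ne' h).symm

/-- The function `x / (1 - x) ^ 2` is invariant under `x ↦ 1 / x`, and `i ↦ 4 * m + 1 - i` exchanges
even and odd exponents. The even exponents therefore give half of the full sum. -/
theorem sum_quarters_add [CharZero L] (hζ : IsPrimitiveRoot ζ (4 * m + 1)) :
    ∑ j ∈ range m, ζ ^ (4 * j + 4) / (1 - ζ ^ (4 * j + 4)) ^ 2 +
      ∑ j ∈ range m, ζ ^ (4 * j + 2) / (1 - ζ ^ (4 * j + 2)) ^ 2 =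
    -((4 * m + 1 : L) ^ 2 - 1) / 24 := by
  set f : ℕ → L := fun i => ζ ^ (i + 1) / (1 - ζ ^ (i + 1)) ^ 2 with hf
  have h := sum_pow_div_one_sub_pow_sq hζ
  push_cast at h
  change ∑ i ∈ range (4 * m), f i = _ at h
  rw [show 4 * m = 2 * (2 * m) by ring, sum_even_odd, ← sum_range_reflect] at h
  have hsymm : ∀ i ∈ range (2 * m), f (2 * (2 * m - 1 - i)) = f (2 * i + 1) := by
    intro i hi
    have hi := mem_range.mp hi
    have h1 : ζ ^ (2 * (2 * m - 1 - i) + 1) * ζ ^ (2 * i + 1 + 1) = 1 := by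
      rw [← pow_add, ← hζ.pow_eq_one]
      congr 1
      omega
    have h2 := one_sub_pow_ne_zero_of_lt hζ (j := 2 * (2 * m - 1 - i) + 1) (by omega) (by omega)
    have h3 := one_sub_pow_ne_zero_of_lt hζ (j := 2 * i + 1 + 1) (by omega) (by omega)
    simp only [hf]
    rw [div_eq_div_iff (pow_ne_zero 2 h2) (pow_ne_zero 2 h3)]
    generalize ζ ^ (2 * (2 * m - 1 - i) + 1) = a at *
    generalize ζ ^ (2 * i + 1 + 1) = b at *
    linear_combination (b - a) * h1
  rw [sum_congr rfl hsymm, ← two_mul, sum_even_odd] at h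
  have e1 : ∀ j, f (2 * (2 * j) + 1) = ζ ^ (4 * j + 2) / (1 - ζ ^ (4 * j + 2)) ^ 2 := fun j => by
    simp only [hf, show 2 * (2 * j) + 1 + 1 = 4 * j + 2 by ring]
  have e2 : ∀ j, f (2 * (2 * j + 1) + 1) = ζ ^ (4 * j + 4) / (1 - ζ ^ (4 * j + 4)) ^ 2 :=
    fun j => by simp only [hf, show 2 * (2 * j + 1) + 1 + 1 = 4 * j + 4 by ring]
  simp only [e1, e2] at h
  linear_combination (1 / 2) * h

/-- Reflection by `1 - ζ ^ (-a) = -ζ ^ (-a) * (1 - ζ ^ a)`; the collected exponents add up to `m *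
(4 * m + 2)`, which is `m` modulo `4 * m + 1`. -/
theorem pow_mul_prod_odd_eq_prod_even (hζ : IsPrimitiveRoot ζ (4 * m + 1)) :
    ζ ^ m * ∏ j ∈ range m, ((1 - ζ ^ (4 * j + 3)) * (1 - ζ ^ (4 * j + 1))) =
      ∏ j ∈ range m, ((1 - ζ ^ (4 * j + 2)) * (1 - ζ ^ (4 * j + 4))) := by
  have h1 : ∀ j ∈ range m, (ζ ^ (8 * j + 6)) * ((1 - ζ ^ (4 * (m - 1 - j) + 3)) *
      (1 - ζ ^ (4 * (m - 1 - j) + 1))) = (1 - ζ ^ (4 * j + 2)) * (1 - ζ ^ (4 * j + 4)) := by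
    intro j hj
    have hj := mem_range.mp hj
    have h1 : ζ ^ (4 * (m - 1 - j) + 3) * ζ ^ (4 * j + 2) = 1 := by
      rw [← pow_add, ← hζ.pow_eq_one]
      congr 1
      omega
    have h2 : ζ ^ (4 * (m - 1 - j) + 1) * ζ ^ (4 * j + 4) = 1 := by
      rw [← pow_add, ← hζ.pow_eq_one]
      congr 1
      omega
    rw [show 8 * j + 6 = (4 * j + 2) + (4 * j + 4) by ring, pow_add]
    linear_combination (ζ ^ (4 * j + 4) * (ζ ^ (4 * (m - 1 - j) + 1) - 1)) * h1 +
      (1 - ζ ^ (4 * j + 2)) * h2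
  have h2 : ∏ j ∈ range m, ζ ^ (8 * j + 6) = ζ ^ m := by
    have : ∀ k, ∏ j ∈ range k, ζ ^ (8 * j + 6) = ζ ^ (k * (4 * k + 2)) := by
      intro k
      induction k with
      | zero => simp
      | succ k ih => rw [prod_range_succ, ih, ← pow_add]; ring_nf
    rw [this, show m * (4 * m + 2) = (4 * m + 1) * m + m by ring, pow_add, pow_mul, hζ.pow_eq_one,
      one_pow, one_mul]
  rw [← h2, ← prod_range_reflect (fun j => (1 - ζ ^ (4 * j + 3)) * (1 - ζ ^ (4 * j + 1))),
    ← prod_mul_distrib]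
  exact prod_congr rfl h1

end

/-! ### The congruence modulo the fourth power -/

/-- First order expansion of a product whose factors are perturbed by a multiple of `v`. -/
theorem HasValue.exists_prod_sub_prod_eq_mul {ζ : ℂ} {v : RatFunc ℚ} {u u' Q : ℕ → RatFunc ℚ}
    {a c : ℕ → ℂ} {m : ℕ} (hu : ∀ j < m, HasValue ζ (u j) (a j))
    (hu' : ∀ j < m, HasValue ζ (u' j) (a j)) (hQ : ∀ j < m, HasValue ζ (Q j) (c j))
    (h : ∀ j < m, u' j - u j = v * (Q j * u j * u' j)) :
    ∃ W, ∏ j ∈ range m, u' j - ∏ j ∈ range m, u j = v * W ∧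
      HasValue ζ W ((∏ j ∈ range m, a j) * ∑ j ∈ range m, c j * a j) := by
  induction m with
  | zero => exact ⟨0, by simp, by simpa using HasValue.zero⟩
  | succ m ih =>
    obtain ⟨W, h1, h2⟩ := ih (fun j hj => hu j (by omega)) (fun j hj => hu' j (by omega))
      (fun j hj => hQ j (by omega)) (fun j hj => h j (by omega))
    refine ⟨W * u' m + (∏ j ∈ range m, u j) * (Q m * u m * u' m), ?_, ?_⟩
    · rw [prod_range_succ, prod_range_succ]
      linear_combination u' m * h1 + (∏ j ∈ range m, u j) * h m (by omega)
    · rw [prod_range_succ, sum_range_succ]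
      convert (h2.mul (hu' m (by omega))).add ((HasValue.prod (range m) fun j hj =>
        hu j (by simp at hj; omega)).mul (((hQ m (by omega)).mul (hu m (by omega))).mul
          (hu' m (by omega)))) using 1
      ring

theorem ratFunc_X_pow_ne_one (j : ℕ) (hj : 0 < j) : (RatFunc.X : RatFunc ℚ) ^ j ≠ 1 := by
  intro h
  rw [← RatFunc.algebraMap_X, ← map_pow, ← map_one (algebraMap ℚ[X] (RatFunc ℚ))] at h
  have h2 := congrArg natDegree (RatFunc.algebraMap_injective ℚ h)
  simp at h2
  omega

/-- The supercongruence modulo the fourth power of the cyclotomic polynomial. -/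
theorem hypSum_sub_eq_cyclotomic_pow_mul {ζ : ℂ} {m : ℕ} (hζ : IsPrimitiveRoot ζ (4 * m + 1))
    {q : RatFunc ℚ} (hq : q = RatFunc.X) : ∃ s ∈ regularAt ζ,
    hypSum (2 * m) q 2 1 - (1 - q ^ (4 * m + 1)) * ((q ^ m)⁻¹ *
      ((∏ j ∈ range m, (1 - q ^ (4 * j + 2))) / ∏ j ∈ range m, (1 - q ^ (4 * j + 4)))) *
      (1 + (1 - q ^ (4 * m + 1)) ^ 2 * (((4 * m + 1 : RatFunc ℚ) ^ 2 - 1) / 24 +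
        ∑ j ∈ range m, q ^ (4 * j + 2) / (1 - q ^ (4 * j + 2)) ^ 2)) =
    algebraMap ℚ[X] (RatFunc ℚ) (cyclotomic (4 * m + 1) ℚ) ^ 4 * s := by
  have hX : HasValue ζ q ζ := hq ▸ HasValue.X
  have hq0 : q ≠ 0 := hq ▸ RatFunc.X_ne_zero
  have hq1 : ∀ j, 0 < j → q ^ j ≠ 1 := hq ▸ ratFunc_X_pow_ne_one
  have hζ0 : ζ ≠ 0 := hζ.ne_zero (by omega)
  have hn : HasValue ζ (q ^ (4 * m + 1)) 1 := hζ.pow_eq_one ▸ hX.pow (4 * m + 1)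
  have hf : ∀ j, HasValue ζ (1 - q ^ j) (1 - ζ ^ j) := fun j => HasValue.one.sub (hX.pow j)
  have hne : ∀ j, 0 < j → j < 4 * m + 1 → 1 - ζ ^ j ≠ 0 := fun j => one_sub_pow_ne_zero_of_lt hζ
  obtain ⟨s₀, hs₀, hmixed⟩ := hypSum_mixed_difference
    (show IsPrimitiveRoot ζ (2 * (2 * m) + 1) by rwa [show 2 * (2 * m) + 1 = 4 * m + 1 by ring]) hq
  rw [show 2 * (2 * m) + 1 = 4 * m + 1 by ring] at hmixed
  have h21 := hypSum_quadratic_one hq1 hq0 m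
  have h12 := hypSum_pow (w := 2) hq1 (quadratic_two_ne_zero hq1) (show m ≤ 2 * m by omega)
  have h22 := hypSum_pow hq1 (quadratic_ne_zero hq1 hq0 m) (show m ≤ 2 * m by omega)
  set w := q ^ (4 * m + 1) + (q ^ (4 * m + 1))⁻¹ with hw
  have hwv : HasValue ζ w 2 := by
    convert hn.add (hn.inv one_ne_zero) using 1
    norm_num
  have h2v : HasValue ζ 2 2 := by simpa using HasValue.ratCast (ζ := ζ) 2
  have hb : ∀ x, HasValue ζ x 2 → ∀ j < m, HasValue ζ
      (1 + q ^ (8 * j + 8) - x * q ^ (4 * j + 4))⁻¹ ((1 - ζ ^ (4 * j + 4)) ^ 2)⁻¹ := by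
    intro x hx j hj
    have := (HasValue.one.add (hX.pow (8 * j + 8))).sub (hx.mul (hX.pow (4 * j + 4)))
    convert this.inv ?_ using 2
    · ring
    · convert pow_ne_zero 2 (hne (4 * j + 4) (by omega) (by omega)) using 1
      ring
  -- Here `v = w - 2`, and `W` is the difference quotient of the products of inverse quadratic
  -- factors between `2` and `w`.
  obtain ⟨W, hW, hWv⟩ := HasValue.exists_prod_sub_prod_eq_mul
    (v := (1 - q ^ (4 * m + 1)) ^ 2 * (q ^ (4 * m + 1))⁻¹) (hb 2 h2v) (hb w hwv)
    (fun j _ => hX.pow (4 * j + 4)) (by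
      intro j hj
      have h1 := quadratic_ne_zero hq1 hq0 m j
      have h2 := quadratic_two_ne_zero hq1 j
      rw [← hw] at h1
      rw [inv_sub_inv h1 h2, div_eq_mul_inv, mul_inv]
      have h3 : (1 - q ^ (4 * m + 1)) ^ 2 * (q ^ (4 * m + 1))⁻¹ = w - 2 := by
        rw [hw]
        field_simp
        ring
      rw [h3]
      ring)
  -- Moving `1 - q` into the product of the `1 - q ^ (4 * j + 5)` releases the last factor `1 - q ^
  -- (4 * m + 1)`.
  have hc : ∀ x : RatFunc ℚ, (1 - q) * ∏ j ∈ range m, (1 - q ^ (4 * j + 3)) *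
      (1 - q ^ (4 * j + 5)) / (1 + q ^ (8 * j + 8) - x * q ^ (4 * j + 4)) =
      (1 - q ^ (4 * m + 1)) * (∏ j ∈ range m, ((1 - q ^ (4 * j + 3)) * (1 - q ^ (4 * j + 1)))) *
        ∏ j ∈ range m, (1 + q ^ (8 * j + 8) - x * q ^ (4 * j + 4))⁻¹ := by
    intro x
    clear hW hWv hb h12 h22 h21 hmixed hne hwv hw hn hζ
    induction m with
    | zero => simp
    | succ m ih =>
      rw [prod_range_succ, prod_range_succ, prod_range_succ, ← mul_assoc, ih]
      ring
  rw [hc] at h12 h22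
  have hD : ∏ j ∈ range m, (1 - q ^ (4 * j + 4)) ≠ 0 :=
    prod_ne_zero_iff.mpr fun j _ => one_sub_pow_ne_zero hq1 (by omega)
  rw [← eq_div_iff (mul_ne_zero (pow_ne_zero m hq0) hD)] at h21
  set c := ∏ j ∈ range m, ((1 - q ^ (4 * j + 3)) * (1 - q ^ (4 * j + 1))) with hcdef
  set e := (q ^ m)⁻¹ * ((∏ j ∈ range m, (1 - q ^ (4 * j + 2))) /
      ∏ j ∈ range m, (1 - q ^ (4 * j + 4)))
    with hedef
  set b := ((4 * m + 1 : RatFunc ℚ) ^ 2 - 1) / 24 +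
        ∑ j ∈ range m, q ^ (4 * j + 2) / (1 - q ^ (4 * j + 2)) ^ 2 with hbdef
  have hcv : HasValue ζ c (∏ j ∈ range m, ((1 - ζ ^ (4 * j + 3)) * (1 - ζ ^ (4 * j + 1)))) :=
    HasValue.prod _ fun j _ => (hf _).mul (hf _)
  have hDζ : ∏ j ∈ range m, (1 - ζ ^ (4 * j + 4)) ≠ 0 :=
    prod_ne_zero_iff.mpr fun j hj => hne _ (by omega) (by simp at hj; omega)
  have hev : HasValue ζ e ((ζ ^ m)⁻¹ *
      ((∏ j ∈ range m, (1 - ζ ^ (4 * j + 2))) / ∏ j ∈ range m, (1 - ζ ^ (4 * j + 4)))) :=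
    ((hX.pow m).inv (pow_ne_zero m hζ0)).mul ((HasValue.prod _ fun j _ => hf _).div
      (HasValue.prod _ fun j _ => hf _) hDζ)
  have hbv : HasValue ζ b (((4 * m + 1 : ℂ) ^ 2 - 1) / 24 +
        ∑ j ∈ range m, ζ ^ (4 * j + 2) / (1 - ζ ^ (4 * j + 2)) ^ 2) := by
    refine HasValue.add ?_ (HasValue.sum _ fun j hj => (hX.pow _).div ((hf _).pow 2)
      (pow_ne_zero 2 (hne _ (by omega) (by simp at hj; omega))))
    have := HasValue.ratCast (ζ := ζ) (((4 * m + 1 : ℚ) ^ 2 - 1) / 24)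
    push_cast at this
    exact this
  -- This is the coefficient of `(1 - q ^ n) ^ 3` in the error, so one more cyclotomic factor is
  -- enough. The reflection formula matches `c` with `e`, and `sum_quarters_add` makes the sums
  -- cancel.
  have hzero : HasValue ζ (c * (q ^ (4 * m + 1))⁻¹ * W + e * b) 0 := by
    convert ((hcv.mul (hn.inv one_ne_zero)).mul hWv).add (hev.mul hbv) using 1
    have h1 := sum_quarters_add hζ
    have h2 := pow_mul_prod_odd_eq_prod_even hζ
    have h3 : ∑ j ∈ range m, ζ ^ (4 * j + 4) * ((1 - ζ ^ (4 * j + 4)) ^ 2)⁻¹ =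
        ∑ j ∈ range m, ζ ^ (4 * j + 4) / (1 - ζ ^ (4 * j + 4)) ^ 2 :=
      sum_congr rfl fun j _ => (div_eq_mul_inv _ _).symm
    rw [h3, prod_inv_distrib, prod_pow]
    rw [prod_mul_distrib (f := fun j => 1 - ζ ^ (4 * j + 2))] at h2
    have hζm := pow_ne_zero m hζ0
    generalize ∏ j ∈ range m, ((1 - ζ ^ (4 * j + 3)) * (1 - ζ ^ (4 * j + 1))) = x1 at *
    generalize ∏ j ∈ range m, (1 - ζ ^ (4 * j + 2)) = x2 at *
    generalize ∏ j ∈ range m, (1 - ζ ^ (4 * j + 4)) = x3 at *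
    generalize ∑ j ∈ range m, ζ ^ (4 * j + 4) / (1 - ζ ^ (4 * j + 4)) ^ 2 = y1 at *
    generalize ∑ j ∈ range m, ζ ^ (4 * j + 2) / (1 - ζ ^ (4 * j + 2)) ^ 2 = y2 at *
    generalize ζ ^ m = t at *
    have h4 : x1 = x2 * x3 / t := by
      rw [eq_div_iff hζm]
      linear_combination h2
    have h5 : y2 = -((4 * m + 1 : ℂ) ^ 2 - 1) / 24 - y1 := by linear_combination h1
    rw [h4, h5]
    field_simp
    ring
  have hn0 : HasValue ζ (1 - q ^ (4 * m + 1)) 0 := by simpa using HasValue.one.sub hn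
  obtain ⟨g, hg, hg'⟩ := hn0.exists_eq_cyclotomic_mul (by omega) hζ
  obtain ⟨t, ht, ht'⟩ := hzero.exists_eq_cyclotomic_mul (by omega) hζ
  set Φ := algebraMap ℚ[X] (RatFunc ℚ) (cyclotomic (4 * m + 1) ℚ)
  refine ⟨g ^ 3 * (s₀ - t), mul_mem (pow_mem hg 3) (sub_mem hs₀ ht), ?_⟩
  have h21' : hypSum (2 * m) q w 1 = (1 - q ^ (4 * m + 1)) * e := by
    rw [h21, hedef]
    field_simp
  rw [h12, h22, h21'] at hmixed
  have hfin : hypSum (2 * m) q 2 1 - (1 - q ^ (4 * m + 1)) * e *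
      (1 + (1 - q ^ (4 * m + 1)) ^ 2 * b) = Φ * (1 - q ^ (4 * m + 1)) ^ 3 * s₀ -
      (1 - q ^ (4 * m + 1)) ^ 3 * (c * (q ^ (4 * m + 1))⁻¹ * W + e * b) := by
    linear_combination hmixed - (1 - q ^ (4 * m + 1)) * c * hW
  rw [hfin, ht', hg']
  ring

/-! ### Regularity and vanishing at roots of smaller order -/

theorem hypTerm_two_one {F : Type*} [Field F] (q : F) (k : ℕ) : hypTerm q 2 1 k =
    qPoch q (q ^ 4) k * qPoch q (q ^ 2) k ^ 3 /
      (qPoch (q ^ 2) (q ^ 2) k * qPoch (q ^ 4) (q ^ 4) k ^ 3) * q ^ (k ^ 2 + k) := by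
  induction k with
  | zero => simp [hypTerm, qPoch]
  | succ k ih =>
    rw [hypTerm_succ, ih]
    simp only [qPoch, prod_range_succ, ratioNum, ratioDen]
    rw [show 1 + q ^ (4 * k + 2) - 2 * q ^ (2 * k + 1) = (1 - q ^ (2 * k + 1)) ^ 2 by ring,
      show 1 + q ^ (8 * k + 8) - 2 * q ^ (4 * k + 4) = (1 - q ^ (4 * k + 4)) ^ 2 by ring,
      show q ^ 2 * (q ^ 2) ^ k = q ^ (2 * k + 2) by ring,
      show q ^ 4 * (q ^ 4) ^ k = q ^ (4 * k + 4) by ring,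
      show q * (q ^ 2) ^ k = q ^ (2 * k + 1) by ring,
      show q * (q ^ 4) ^ k = q ^ (4 * k + 1) by ring, one_mul]
    generalize 1 - q ^ (2 * k + 1) = x1
    generalize 1 - q ^ (4 * k + 1) = x2
    generalize 1 - q ^ (4 * k + 4) = x3
    generalize 1 - q ^ (2 * k + 2) = x4
    ring

section

variable {ζ : ℂ} {d : ℕ}

/-- The zero at `ζ` is simple when `d ∣ s`: the cofactor is a geometric sum with value `s / d`
there. -/
theorem exists_one_sub_pow_eq (hζ : IsPrimitiveRoot ζ d) {q : RatFunc ℚ}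
    (hq : q = RatFunc.X) {s : ℕ} (hs : 0 < s) : ∃ v c, HasValue ζ v c ∧ c ≠ 0 ∧
    1 - q ^ s = (1 - q ^ d) ^ (if d ∣ s then 1 else 0) * v := by
  have hX : HasValue ζ q ζ := hq ▸ HasValue.X
  split_ifs with h
  · obtain ⟨t, rfl⟩ := h
    refine ⟨∑ i ∈ range t, (q ^ d) ^ i, ∑ i ∈ range t, (ζ ^ d) ^ i,
      HasValue.sum _ fun i _ => (hX.pow d).pow i, ?_, ?_⟩
    · simpa [hζ.pow_eq_one] using (pos_of_mul_pos_right hs (Nat.zero_le d)).ne'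
    · rw [pow_one, mul_neg_geom_sum, pow_mul]
  · refine ⟨1 - q ^ s, _, HasValue.one.sub (hX.pow s), ?_, by simp⟩
    rw [sub_ne_zero, ne_comm, ne_eq, hζ.pow_eq_one_iff_dvd]
    exact h

theorem exists_prod_one_sub_pow_eq (hζ : IsPrimitiveRoot ζ d) {q : RatFunc ℚ}
    (hq : q = RatFunc.X) {s : ℕ → ℕ} (hs : ∀ i, 0 < s i) (k : ℕ) : ∃ v c, HasValue ζ v c ∧ c ≠ 0 ∧
    ∏ i ∈ range k, (1 - q ^ s i) = (1 - q ^ d) ^ (Nat.count (fun i => d ∣ s i) k) * v := by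
  induction k with
  | zero => exact ⟨1, 1, HasValue.one, one_ne_zero, by simp⟩
  | succ k ih =>
    obtain ⟨v, c, hv, hc, h⟩ := ih
    obtain ⟨v', c', hv', hc', h'⟩ := exists_one_sub_pow_eq hζ hq (hs k)
    refine ⟨v * v', c * c', hv.mul hv', mul_ne_zero hc hc', ?_⟩
    rw [prod_range_succ, h, h', Nat.count_succ, pow_add]
    ring

/-- As `b` is invertible modulo `d`, every block of `d` consecutive indices contains a solution. -/
theorem div_le_count_dvd_add_mul {b : ℕ} (hd : 0 < d) (hbd : b.Coprime d) (a k : ℕ) :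
    k / d ≤ Nat.count (fun i => d ∣ a + b * i) k := by
  have : NeZero d := ⟨hd.ne'⟩
  obtain ⟨v, hv⟩ : ∃ v : ℕ, d ∣ a + b * v := by
    refine ⟨(-(a : ZMod d) * (b : ZMod d)⁻¹).val, ?_⟩
    rw [← ZMod.natCast_eq_zero_iff]
    push_cast
    rw [ZMod.natCast_zmod_val]
    linear_combination (-(a : ZMod d)) * ZMod.coe_mul_inv_eq_one b hbd
  refine (Nat.le_add_right _ _).trans ((Nat.count_modEq_card k hd v).ge.trans
    (Nat.count_mono_left fun i _ hi => ?_))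
  exact (((hi.mul_left b).add_left a).dvd_iff dvd_rfl).mpr hv

theorem count_dvd_mul_succ {b : ℕ} (hbd : b.Coprime d) (k : ℕ) :
    Nat.count (fun i => d ∣ b + b * i) k = k / d := by
  rw [← Nat.card_multiples k d, Nat.count_eq_card_filter_range]
  congr 1
  refine filter_congr fun i _ => ?_
  rw [show b + b * i = b * (i + 1) by ring, hbd.symm.dvd_mul_left]

/-- Quotients of `q`-shifted factorials are regular at roots of unity whose order is coprime to the
steps. -/
theorem qPoch_div_qPoch_mem_regularAt (hd : 0 < d) (hζ : IsPrimitiveRoot ζ d) {q : RatFunc ℚ}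
    (hq : q = RatFunc.X) {a b c : ℕ} (ha : 0 < a) (hc : 0 < c) (hbd : b.Coprime d)
    (hcd : c.Coprime d) (k : ℕ) :
    qPoch (q ^ a) (q ^ b) k / qPoch (q ^ c) (q ^ c) k ∈ regularAt ζ := by
  have hX : HasValue ζ q ζ := hq ▸ HasValue.X
  obtain ⟨v, x, hv, hx, h⟩ := exists_prod_one_sub_pow_eq hζ hq (s := fun i => a + b * i)
    (fun i => by omega) k
  obtain ⟨v', x', hv', hx', h'⟩ := exists_prod_one_sub_pow_eq hζ hq (s := fun i => c + c * i)
    (fun i => by omega) k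
  rw [count_dvd_mul_succ hcd] at h'
  -- The denominator vanishes at `ζ` to order exactly `k / d`, the numerator to at least that order.
  obtain ⟨r, hr⟩ := Nat.exists_eq_add_of_le (div_le_count_dvd_add_mul hd hbd a k)
  rw [hr] at h
  simp only [qPoch, ← pow_mul, ← pow_add]
  rw [h, h', pow_add, mul_assoc, mul_div_mul_left _ _ (pow_ne_zero _ (one_sub_pow_ne_zero
    (hq ▸ ratFunc_X_pow_ne_one) hd)), mul_div_assoc]
  exact mul_mem (pow_mem (sub_mem (one_mem _) (pow_mem hX.1 _)) _) (hv.div hv' hx').1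

theorem hypTerm_mem_regularAt (hd : 0 < d) (hζ : IsPrimitiveRoot ζ d) {q : RatFunc ℚ}
    (hq : q = RatFunc.X) (h2 : Nat.Coprime 2 d) (k : ℕ) : hypTerm q 2 1 k ∈ regularAt ζ := by
  have hX : HasValue ζ q ζ := hq ▸ HasValue.X
  have h4 : Nat.Coprime 4 d := h2.pow_left 2
  have e1 := qPoch_div_qPoch_mem_regularAt hd hζ hq one_pos two_pos h4 h2 k
  have e2 := qPoch_div_qPoch_mem_regularAt hd hζ hq one_pos four_pos h2 h4 k
  rw [pow_one] at e1 e2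
  rw [hypTerm_two_one, mul_div_mul_comm, ← div_pow]
  exact mul_mem (mul_mem e1 (pow_mem e2 3)) (pow_mem hX.1 _)

theorem hasValue_ratio_two_one {q : RatFunc ℚ} (hq : q = RatFunc.X) (hζ : ζ ^ d = 1) (l i : ℕ)
    (h : ratioDen ζ 2 1 i ≠ 0) :
    HasValue ζ (ratioNum q 2 1 (l * d + i) / ratioDen q 2 1 (l * d + i))
      (ratioNum ζ 2 1 i / ratioDen ζ 2 1 i) := by
  have hX : HasValue ζ q ζ := hq ▸ HasValue.X
  have hone : HasValue ζ 1 1 := HasValue.one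
  have htwo : HasValue ζ 2 2 := by simpa using HasValue.ratCast (ζ := ζ) 2
  have hpow : ∀ a b, HasValue ζ (q ^ (a * (l * d + i) + b)) (ζ ^ (a * i + b)) := by
    intro a b
    convert hX.pow (a * (l * d + i) + b) using 1
    rw [show a * (l * d + i) + b = d * (a * l) + (a * i + b) by ring, pow_add ζ (d * (a * l)),
      pow_mul ζ d, hζ, one_pow, one_mul]
  exact ((((hone.sub (hpow 2 1)).mul ((hone.add (hpow 4 2)).sub (htwo.mul (hpow 2 1)))).mul
    (hone.sub (hpow 4 1))).mul (hpow 2 2)).div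
      (((hone.sub (hpow 4 4)).mul ((hone.add (hpow 8 8)).sub (htwo.mul (hpow 4 4)))).mul
        (hone.sub (hone.mul (hpow 2 2)))) h

end

theorem hypSum_two_one_eq_zero {ζ : ℂ} {M K : ℕ} (hζ : IsPrimitiveRoot ζ (2 * M + 1)) (h : M ≤ K) :
    hypSum K ζ 2 1 = 0 := by
  induction K, h using Nat.le_induction with
  | base =>
    have h1 := polySum_eq_hypSum_mul (q := ζ) (w := 2) (z := 1) (M := M)
      fun i hi => ratioDen_two_one_ne_zero hζ (by omega)
    rw [polySum_eq_zero_of_isPrimitiveRoot hζ, eq_comm, mul_eq_zero] at h1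
    exact h1.resolve_right (prod_ne_zero_iff.mpr fun i hi =>
      ratioDen_two_one_ne_zero hζ (by simp at hi; omega))
  | succ K hK ih =>
    -- Past index `M` a numerator factor `1 - ζ ^ (2 * M + 1)` is present, so later zero
    -- denominators, read as `x / 0 = 0`, do no harm.
    have : hypTerm ζ 2 1 (K + 1) = 0 :=
      prod_eq_zero (mem_range.mpr (show M < K + 1 by omega))
        (by simp [ratioNum, hζ.pow_eq_one])
    rw [hypSum_succ, ih, this, mul_zero, add_zero]

/-- The terms of the series from `l * d` on, summed over (a part of) a period of length `d`. -/
theorem hasValue_sum_period {ζ : ℂ} {M K : ℕ} (hζ : IsPrimitiveRoot ζ (2 * M + 1))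
    {q : RatFunc ℚ} (hq : q = RatFunc.X) (hM : M ≤ K) (hK : K ≤ 2 * M) (l : ℕ) :
    HasValue ζ (∑ r ∈ range (K + 1), (1 - q ^ (6 * (l * (2 * M + 1) + r) + 1)) *
      hypTerm q 2 1 (l * (2 * M + 1) + r)) 0 := by
  have hX : HasValue ζ q ζ := hq ▸ HasValue.X
  -- The term opening the period is regular as a whole, though single ratios before it need not be.
  -- Within the period the ratios are regular and depend only on the index modulo the order.
  have hpre := hypTerm_mem_regularAt (by omega) hζ hq (by simp) (l * (2 * M + 1))
  have h0 := (HasValue.mk_evalAt ⟨_, hpre⟩).mul (HasValue.sum (range (K + 1)) (fun r hr =>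
    (HasValue.one.sub (hX.pow (6 * (l * (2 * M + 1) + r) + 1))).mul (HasValue.prod (range r)
      fun i hi => hasValue_ratio_two_one hq hζ.pow_eq_one l i
        (ratioDen_two_one_ne_zero hζ (by simp at hr hi; omega)))))
  convert h0 using 1
  · rw [mul_sum]
    refine sum_congr rfl fun r _ => ?_
    rw [hypTerm, prod_range_add, ← hypTerm]
    ring
  · rw [eq_comm, mul_eq_zero]
    right
    rw [← hypSum_two_one_eq_zero hζ hM, hypSum]
    refine sum_congr rfl fun r _ => ?_
    rw [show 6 * (l * (2 * M + 1) + r) + 1 = (2 * M + 1) * (6 * l) + (6 * r + 1) by ring, pow_add,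
      pow_mul, hζ.pow_eq_one, one_pow, one_mul, hypTerm]

/-- The range consists of `l` full periods and one initial half period, each of value zero. -/
theorem hasValue_hypSum_two_one {ζ : ℂ} {M : ℕ} (hζ : IsPrimitiveRoot ζ (2 * M + 1))
    {q : RatFunc ℚ} (hq : q = RatFunc.X) (l : ℕ) :
    HasValue ζ (hypSum (l * (2 * M + 1) + M) q 2 1) 0 := by
  have h : ∀ l, HasValue ζ (∑ k ∈ range (l * (2 * M + 1)),
      (1 - q ^ (6 * k + 1)) * hypTerm q 2 1 k) 0 := by
    intro l
    induction l with
    | zero => simpa using HasValue.zero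
    | succ l ih =>
      rw [add_mul, one_mul, sum_range_add]
      simpa using ih.add (hasValue_sum_period hζ hq (by omega) le_rfl l)
  rw [hypSum, add_assoc, sum_range_add]
  simpa using (h l).add (hasValue_sum_period hζ hq le_rfl (by omega) l)

theorem one_sub_pow_div_mem_regularAt {ζ : ℂ} {d n s : ℕ} (hd : 0 < d) (hζ : IsPrimitiveRoot ζ d)
    {q : RatFunc ℚ} (hq : q = RatFunc.X) (hdn : d ∣ n) (hn : 0 < n) (hs : 0 < s) :
    (1 - q ^ n) / (1 - q ^ s) ∈ regularAt ζ := by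
  obtain ⟨v, c, hv, hc, h⟩ := exists_one_sub_pow_eq hζ hq hn
  obtain ⟨v', c', hv', hc', h'⟩ := exists_one_sub_pow_eq hζ hq hs
  have hd0 : 1 - q ^ d ≠ 0 := one_sub_pow_ne_zero (hq ▸ ratFunc_X_pow_ne_one) hd
  rw [if_pos hdn, pow_one] at h
  rw [h, h']
  split_ifs
  · rw [pow_one, mul_div_mul_left _ _ hd0]
    exact (hv.div hv' hc').1
  · rw [pow_zero, one_mul, mul_div_assoc]
    exact mul_mem (sub_mem (one_mem _) (pow_mem (hq ▸ HasValue.X.1) d)) (hv.div hv' hc').1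

/-- The leading factor vanishes at `ζ`. The rest is regular: double poles in the sum are absorbed by
`(1 - q ^ (4 * m + 1)) ^ 2`. -/
theorem hasValue_zero_closed_form {ζ : ℂ} {d m : ℕ} (hd : 0 < d) (hζ : IsPrimitiveRoot ζ d)
    {q : RatFunc ℚ} (hq : q = RatFunc.X) (hdn : d ∣ 4 * m + 1) (h4 : Nat.Coprime 4 d) :
    HasValue ζ ((1 - q ^ (4 * m + 1)) * ((q ^ m)⁻¹ *
      ((∏ j ∈ range m, (1 - q ^ (4 * j + 2))) / ∏ j ∈ range m, (1 - q ^ (4 * j + 4)))) *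
      (1 + (1 - q ^ (4 * m + 1)) ^ 2 * (((4 * m + 1 : RatFunc ℚ) ^ 2 - 1) / 24 +
        ∑ j ∈ range m, q ^ (4 * j + 2) / (1 - q ^ (4 * j + 2)) ^ 2))) 0 := by
  have hX : HasValue ζ q ζ := hq ▸ HasValue.X
  have hn : HasValue ζ (1 - q ^ (4 * m + 1)) 0 := by
    have := HasValue.one.sub (hX.pow (4 * m + 1))
    rwa [(hζ.pow_eq_one_iff_dvd _).mpr hdn, sub_self] at this
  have he : (∏ j ∈ range m, (1 - q ^ (4 * j + 2))) / ∏ j ∈ range m, (1 - q ^ (4 * j + 4)) ∈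
      regularAt ζ := by
    convert qPoch_div_qPoch_mem_regularAt hd hζ hq two_pos four_pos h4 h4 m using 1
    simp only [qPoch, ← pow_mul, ← pow_add, add_comm]
  have hb : (1 - q ^ (4 * m + 1)) ^ 2 * (((4 * m + 1 : RatFunc ℚ) ^ 2 - 1) / 24 +
        ∑ j ∈ range m, q ^ (4 * j + 2) / (1 - q ^ (4 * j + 2)) ^ 2) ∈ regularAt ζ := by
    rw [mul_add, mul_sum]
    refine add_mem (mul_mem (pow_mem hn.1 2) ?_) (sum_mem fun j _ => ?_)
    · have := (HasValue.ratCast (ζ := ζ) (((4 * m + 1 : ℚ) ^ 2 - 1) / 24)).1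
      push_cast at this
      exact this
    · rw [mul_div_left_comm, ← div_pow]
      exact mul_mem (pow_mem hX.1 _)
        (pow_mem (one_sub_pow_div_mem_regularAt hd hζ hq hdn (by omega) (by omega)) 2)
  have := (hn.mul (((hX.pow m).inv (pow_ne_zero m (hζ.ne_zero hd.ne'))).mul
    (HasValue.mk_evalAt ⟨_, he⟩))).mul (HasValue.one.add (HasValue.mk_evalAt ⟨_, hb⟩))
  simpa only [zero_mul] using this

/-! ### Assembling the cyclotomic factors -/

theorem qInt_sq_mul_B {q : RatFunc ℚ} (hq : q = RatFunc.X) (m : ℕ) :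
    qInt q (4 * m + 1) ^ 2 * B (4 * m + 1) q =
      (1 - q ^ (4 * m + 1)) ^ 2 * (((4 * m + 1 : RatFunc ℚ) ^ 2 - 1) / 24 +
        ∑ j ∈ range m, q ^ (4 * j + 2) / (1 - q ^ (4 * j + 2)) ^ 2) := by
  have hq1 : 1 - q ≠ 0 := by
    simpa using one_sub_pow_ne_zero (q := q) (hq ▸ ratFunc_X_pow_ne_one) one_pos
  have hsum : ∑ k ∈ Icc 1 m, q ^ (4 * k - 2) / qInt q (4 * k - 2) ^ 2 =
      (1 - q) ^ 2 * ∑ j ∈ range m, q ^ (4 * j + 2) / (1 - q ^ (4 * j + 2)) ^ 2 := by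
    rw [← Finset.Ico_add_one_right_eq_Icc, sum_Ico_eq_sum_range, mul_sum, Nat.add_sub_cancel]
    refine sum_congr rfl fun j _ => ?_
    rw [show 4 * (1 + j) - 2 = 4 * j + 2 by omega, qInt, div_pow, div_div_eq_mul_div]
    ring
  rw [B, show (4 * m + 1 - 1) / 4 = m by omega, hsum, qInt]
  push_cast
  field_simp

/-- `[n]` is the product of the pairwise coprime `Φ_d` over divisors `d > 1` of `n`; its factor
`Φ_n` joins the cube. -/
theorem qIntPoly_mul_cyclotomic_dvd {n : ℕ} (hn : 1 < n) {p : ℚ[X]} (h : cyclotomic n ℚ ^ 4 ∣ p)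
    (h' : ∀ d, 1 < d → d < n → d ∣ n → cyclotomic d ℚ ∣ p) :
    qIntPoly n * cyclotomic n ℚ ^ 3 ∣ p := by
  have hmem : n ∈ n.divisors.erase 1 := by simp; omega
  rw [qIntPoly, ← prod_cyclotomic_eq_geom_sum (by omega), ← mul_prod_erase _ _ hmem]
  have : cyclotomic n ℚ * (∏ x ∈ (n.divisors.erase 1).erase n, cyclotomic x ℚ) *
      cyclotomic n ℚ ^ 3 =
      cyclotomic n ℚ ^ 4 * ∏ x ∈ (n.divisors.erase 1).erase n, cyclotomic x ℚ := by ring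
  rw [this]
  refine IsCoprime.mul_dvd ?_ h (Finset.prod_dvd_of_coprime ?_ ?_)
  · exact IsCoprime.pow_left (IsCoprime.prod_right fun d hd =>
      cyclotomic.isCoprime_rat (mem_erase.mp hd).1.symm)
  · exact fun a _ b _ hab => cyclotomic.isCoprime_rat hab
  · intro d hd
    simp only [mem_erase, Nat.mem_divisors] at hd
    obtain ⟨h1, h2, h3, h4⟩ := hd
    have := Nat.pos_of_dvd_of_pos h3 (by omega)
    exact h' d (by omega) (lt_of_le_of_ne (Nat.le_of_dvd (by omega) h3) h1) h3

/-- The supercongruence, with both sides written over the common denominator `1 - q`. -/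
theorem ratCongr_hypSum_closedForm (m : ℕ) (q : RatFunc ℚ) (hq : q = RatFunc.X) :
    RatCongr (qIntPoly (4 * m + 1) * cyclotomic (4 * m + 1) ℚ ^ 3)
      (hypSum (2 * m) q 2 1 / (1 - q)) (((1 - q ^ (4 * m + 1)) * ((q ^ m)⁻¹ *
      ((∏ j ∈ range m, (1 - q ^ (4 * j + 2))) /
        ∏ j ∈ range m, (1 - q ^ (4 * j + 4)))) *
      (1 + (1 - q ^ (4 * m + 1)) ^ 2 * (((4 * m + 1 : RatFunc ℚ) ^ 2 - 1) / 24 +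
        ∑ j ∈ range m, q ^ (4 * j + 2) / (1 - q ^ (4 * j + 2)) ^ 2))) / (1 - q)) := by
  rw [RatCongr, ← sub_div]
  rcases Nat.eq_zero_or_pos m with rfl | hm
  · simp [hypSum, hypTerm]
  have hinv : ∀ (d : ℕ), 1 < d → ∀ ζ : ℂ, IsPrimitiveRoot ζ d → HasValue ζ (1 - q)⁻¹ (1 - ζ)⁻¹ :=
    fun d hd ζ hζ => (HasValue.one.sub (hq ▸ HasValue.X)).inv
      (sub_ne_zero.mpr (hζ.ne_one hd).symm)
  refine qIntPoly_mul_cyclotomic_dvd (by omega) ?_ ?_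
  · have hζ := Complex.isPrimitiveRoot_exp (4 * m + 1) (by omega)
    obtain ⟨s, hs, h⟩ := hypSum_sub_eq_cyclotomic_pow_mul hζ hq
    refine cyclotomic_pow_dvd_num (by omega) hζ
      (mul_mem hs (hinv _ (by omega) _ hζ).1) ?_
    rw [h, div_eq_mul_inv, mul_assoc]
  · intro d hd _ hdvd
    have hζ := Complex.isPrimitiveRoot_exp d (by omega)
    set ζ := Complex.exp (2 * Real.pi * Complex.I / d)
    have hodd : Odd (4 * m + 1) := ⟨2 * m, by ring⟩
    obtain ⟨e, he⟩ := hdvd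
    rw [he, Nat.odd_mul] at hodd
    obtain ⟨⟨M, rfl⟩, ⟨l, rfl⟩⟩ := hodd
    -- From `n = (2 * M + 1) * (2 * l + 1)`: the truncation point `(n - 1) / 2` lies half-way
    -- through a period.
    have hm' : 2 * m = l * (2 * M + 1) + M := by linarith
    refine HasValue.cyclotomic_dvd_num (by omega) hζ ?_
    have h4 : Nat.Coprime 4 (2 * M + 1) := Nat.Coprime.pow_left 2 (by simp : Nat.Coprime 2 _)
    have h1 := hasValue_hypSum_two_one hζ hq l
    rw [← hm'] at h1
    have h2 := hasValue_zero_closed_form (by omega) hζ hq ⟨_, he⟩ h4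
    simpa only [sub_self, zero_mul, zero_div, ← div_eq_mul_inv] using
      (h1.sub h2).mul (hinv _ hd _ hζ)

end QCong

theorem theorem2 (n : ℕ) (hn : n ≡ 1 [MOD 4]) (q : RatFunc ℚ) (hq : q = RatFunc.X) :
    QCong.RatCongr (QCong.qIntPoly n * Polynomial.cyclotomic n ℚ ^ 3)
      (∑ k ∈ Finset.range ((n - 1) / 2 + 1),
        QCong.qInt q (6 * k + 1) *
          (QCong.qPoch q (q ^ 4) k * QCong.qPoch q (q ^ 2) k ^ 3 /
            (QCong.qPoch (q ^ 2) (q ^ 2) k * QCong.qPoch (q ^ 4) (q ^ 4) k ^ 3)) *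
          q ^ (k ^ 2 + k))
      (QCong.qPoch (q ^ 2) (q ^ 4) ((n - 1) / 4) / QCong.qPoch (q ^ 4) (q ^ 4) ((n - 1) / 4) *
        QCong.qInt q n * q ^ ((1 - (n : ℤ)) / 4) *
        (1 + QCong.qInt q n ^ 2 * QCong.B n q)) := by
  obtain ⟨m, rfl⟩ : ∃ m, n = 4 * m + 1 := by
    refine ⟨n / 4, ?_⟩
    have : n % 4 = 1 := hn
    omega
  convert QCong.ratCongr_hypSum_closedForm m q hq using 1
  · rw [show (4 * m + 1 - 1) / 2 = 2 * m by omega, QCong.hypSum, Finset.sum_div]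
    refine Finset.sum_congr rfl fun k _ => ?_
    rw [QCong.hypTerm_two_one, QCong.qInt]
    ring
  · rw [QCong.qInt_sq_mul_B hq, show (4 * m + 1 - 1) / 4 = m by omega,
      show (1 - ((4 * m + 1 : ℕ) : ℤ)) / 4 = -(m : ℤ) by push_cast; omega, zpow_neg, zpow_natCast,
      QCong.qInt]
    simp only [QCong.qPoch, ← pow_mul, ← pow_add]
    simp only [add_comm (4 * _) 2, add_comm (4 * _) 4]
    ring
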